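/- The ground field is $\mathbb C$. For a superspace $V=V_{\bar 0}\oplus V_{\bar 1}$ with dual superspace $V^*$, let $S(V^*)$ be its supersymmetric algebra, i.e. the tensor algebra of $V^*$ modulo the relations $ab=(-1)^{|a||b|}ba$ for homogeneous $a,b\in V^*$. If a Lie superalgebra $\mathfrak g$ acts on $V$, then it acts on $V^*$ by $(x\alpha)(v)=-(-1)^{|x||\alpha|}\alpha(xv)$ and on $S(V^*)$ by the superderivations extending this action; $S(V^*)^{\mathfrak g}$ denotes the subalgebra of the elements killed by all of $\mathfrak g$. For a subsuperspace $L\subset V$ the restriction map $S(V^*)\to S(L^*)$ is the algebra homomorphism induced by the restriction of linear forms. (1) Proposition. Let $\mathfrak g$ be a finite-dimensional Lie superalgebra, $V$ a finite-dimensional $\mathfrak g$-module, $L\subset V$ a subsuperspace and $w_0\in L_{\bar 0}$ an even element of $L$ such that the map $\mathfrak g\times L\to V$, $(x,w)\mapsto xw_0+w$, is surjective. Then the restriction map $S(V^*)^{\mathfrak g}\to S(L^*)$ is injective. (2) Corollary. Let $\mathfrak g$ be a finite-dimensional Lie superalgebra and $\mathfrak h$ a Cartan subalgebra of $\mathfrak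 g$, i.e. a nilpotent subsuperalgebra that is equal to its own normalizer $\{x\in\mathfrak g : [x,\mathfrak h]\subset\mathfrak h\}$. Then the restriction map $S(\mathfrak g^*)^{\mathfrak g}\to S(\mathfrak h^*)$ is injective, where $\mathfrak g$ acts on itself by the adjoint action. -/

import Mathlib

universe u v

noncomputable section

/-! ### Signs, superspaces and parity

A superspace is a complex vector space `V` with a grading `𝒱 : ZMod 2 → Submodule ℂ V` (a family
of subspaces together with an instance `DirectSum.Decomposition 𝒱`); `𝒱 0` is the even part and
`𝒱 1` is the odd part. -/

/-- The sign `(-1) ^ (i j)` attached to two parities `i j : ZMod 2`. -/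
def superSign (i j : ZMod 2) : ℂ := (-1) ^ (i.val * j.val)

theorem superSign_add_left (p i j : ZMod 2) :
    superSign (p + i) j = superSign p j * superSign i j := by
  have h : ∀ p i j : ZMod 2, (-1 : ℤ) ^ ((p + i).val * j.val) =
    (-1) ^ (p.val * j.val) * (-1) ^ (i.val * j.val) := by decide
  unfold superSign
  exact_mod_cast h p i j

theorem superSign_mul_add_right (p i j : ZMod 2) :
    superSign p i * superSign i (p + j) = superSign i j := by
  have h : ∀ p i j : ZMod 2, (-1 : ℤ) ^ (p.val * i.val) * (-1) ^ (i.val * (p + j).val) =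
    (-1) ^ (i.val * j.val) := by decide
  unfold superSign
  exact_mod_cast h p i j

/-- The sign automorphism of a superspace attached to a parity `p`: a homogeneous `a` of parity
`i` goes to `(-1) ^ (p i) a`.  It is the identity for `p = 0`. -/
def parityTwist {M : Type*} [AddCommGroup M] [Module ℂ M] (ℳ : ZMod 2 → Submodule ℂ M)
    [DirectSum.Decomposition ℳ] (p : ZMod 2) : M →ₗ[ℂ] M where
  toFun m := ∑ i : ZMod 2, superSign p i • (DirectSum.decompose ℳ m i : M)
  map_add' x y := by
    simp [DirectSum.decompose_add, smul_add, Finset.sum_add_distrib]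
  map_smul' c x := by
    simp only [DirectSum.decompose_smul, DirectSum.smul_apply, Submodule.coe_smul,
      Finset.smul_sum, RingHom.id_apply]
    exact Finset.sum_congr rfl fun i _ => smul_comm _ _ _

theorem parityTwist_of_mem {M : Type*} [AddCommGroup M] [Module ℂ M]
    (ℳ : ZMod 2 → Submodule ℂ M) [DirectSum.Decomposition ℳ] (p : ZMod 2) {i : ZMod 2} {a : M}
    (ha : a ∈ ℳ i) : parityTwist ℳ p a = superSign p i • a := by
  change ∑ j : ZMod 2, superSign p j • (DirectSum.decompose ℳ a j : M) = _
  rw [Finset.sum_eq_single i]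
  · rw [DirectSum.decompose_of_mem_same ℳ ha]
  · intro j _ hj
    rw [DirectSum.decompose_of_mem_ne ℳ ha (Ne.symm hj), smul_zero]
  · simp

/-- A subsuperspace: a subspace which contains the even and the odd part of each of its
elements. -/
def IsSubsuperspace {V : Type*} [AddCommGroup V] [Module ℂ V] (𝒱 : ZMod 2 → Submodule ℂ V)
    [DirectSum.Decomposition 𝒱] (L : Submodule ℂ V) : Prop :=
  ∀ v ∈ L, ∀ i : ZMod 2, (DirectSum.decompose 𝒱 v i : V) ∈ L

/-- The grading induced on a subspace (it is a decomposition when `L` is a subsuperspace). -/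
def subGrading {V : Type*} [AddCommGroup V] [Module ℂ V] (𝒱 : ZMod 2 → Submodule ℂ V)
    (L : Submodule ℂ V) (i : ZMod 2) : Submodule ℂ L :=
  (𝒱 i).comap L.subtype

/-- The grading of the dual superspace: a linear form has parity `i` if it vanishes on the
vectors of the other parity. -/
def dualGrading {V : Type*} [AddCommGroup V] [Module ℂ V] (𝒱 : ZMod 2 → Submodule ℂ V)
    (i : ZMod 2) : Submodule ℂ (Module.Dual ℂ V) :=
  (𝒱 (i + 1)).dualAnnihilator

theorem dualGrading_isInternal {V : Type*} [AddCommGroup V] [Module ℂ V]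
    (𝒱 : ZMod 2 → Submodule ℂ V) [DirectSum.Decomposition 𝒱] :
    DirectSum.IsInternal (dualGrading 𝒱) := by
  have huniv : (Set.univ : Set (ZMod 2)) = {0, 1} := by
    refine (Set.eq_univ_of_forall fun i => ?_).symm
    revert i
    decide
  have h := (DirectSum.isInternal_submodule_iff_isCompl 𝒱 (i := 0) (j := 1) (by decide)
    huniv).1 (DirectSum.Decomposition.isInternal 𝒱)
  rw [DirectSum.isInternal_submodule_iff_isCompl (dualGrading 𝒱) (i := 0) (j := 1) (by decide)
    huniv]
  exact (Subspace.isCompl_dualAnnihilator h).symm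

instance dualGrading.decomposition {V : Type*} [AddCommGroup V] [Module ℂ V]
    (𝒱 : ZMod 2 → Submodule ℂ V) [DirectSum.Decomposition 𝒱] :
    DirectSum.Decomposition (dualGrading 𝒱) :=
  (dualGrading_isInternal 𝒱).chooseDecomposition

/-! ### The supersymmetric algebra of a superspace -/

/-- The relations `a b = (-1) ^ (i j) b a` for homogeneous `a`, `b` of parities `i`, `j`. -/
inductive SuperSym.Rel {M : Type*} [AddCommGroup M] [Module ℂ M] (ℳ : ZMod 2 → Submodule ℂ M) :
    TensorAlgebra ℂ M → TensorAlgebra ℂ M → Prop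
  | comm (i j : ZMod 2) (a b : M) (ha : a ∈ ℳ i) (hb : b ∈ ℳ j) :
      SuperSym.Rel ℳ (TensorAlgebra.ι ℂ a * TensorAlgebra.ι ℂ b)
        (superSign i j • (TensorAlgebra.ι ℂ b * TensorAlgebra.ι ℂ a))

/-- The supersymmetric algebra `S(M)` of a superspace: the tensor algebra of `M` modulo
supercommutativity. -/
def SuperSym {M : Type*} [AddCommGroup M] [Module ℂ M] (ℳ : ZMod 2 → Submodule ℂ M) : Type _ :=
  RingQuot (SuperSym.Rel ℳ)

namespace SuperSym

section

variable {M : Type*} [AddCommGroup M] [Module ℂ M] (ℳ : ZMod 2 → Submodule ℂ M)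

instance : Ring (SuperSym ℳ) := inferInstanceAs (Ring (RingQuot (Rel ℳ)))

instance : Algebra ℂ (SuperSym ℳ) := inferInstanceAs (Algebra ℂ (RingQuot (Rel ℳ)))

/-- The canonical map `M → S(M)`. -/
def ι : M →ₗ[ℂ] SuperSym ℳ :=
  (RingQuot.mkAlgHom ℂ (Rel ℳ)).toLinearMap ∘ₗ TensorAlgebra.ι ℂ

theorem ι_mul_ι {i j : ZMod 2} {a b : M} (ha : a ∈ ℳ i) (hb : b ∈ ℳ j) :
    ι ℳ a * ι ℳ b = superSign i j • (ι ℳ b * ι ℳ a) := by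
  have h := RingQuot.mkAlgHom_rel ℂ (Rel.comm i j a b ha hb)
  rw [map_smul, map_mul, map_mul] at h
  exact h

variable {A : Type*} [Ring A] [Algebra ℂ A]

/-- The universal property of `S(M)`. -/
def lift (f : M →ₗ[ℂ] A)
    (hf : ∀ i j : ZMod 2, ∀ a ∈ ℳ i, ∀ b ∈ ℳ j, f a * f b = superSign i j • (f b * f a)) :
    SuperSym ℳ →ₐ[ℂ] A :=
  RingQuot.liftAlgHom ℂ ⟨TensorAlgebra.lift ℂ f, by
    rintro _ _ ⟨i, j, a, b, ha, hb⟩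
    simpa using hf i j a ha b hb⟩

@[simp]
theorem lift_ι (f : M →ₗ[ℂ] A)
    (hf : ∀ i j : ZMod 2, ∀ a ∈ ℳ i, ∀ b ∈ ℳ j, f a * f b = superSign i j • (f b * f a))
    (a : M) : lift ℳ f hf (ι ℳ a) = f a := by
  have h := RingQuot.liftAlgHom_mkAlgHom_apply ℂ (TensorAlgebra.lift ℂ f) (s := Rel ℳ) (by
    rintro _ _ ⟨i, j, a, b, ha, hb⟩
    simpa using hf i j a ha b hb) (TensorAlgebra.ι ℂ a)
  rw [TensorAlgebra.lift_ι_apply] at h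
  exact h

variable {ℳ} in
theorem algHom_ext {f g : SuperSym ℳ →ₐ[ℂ] A} (h : ∀ a, f (ι ℳ a) = g (ι ℳ a)) : f = g := by
  refine RingQuot.ringQuot_ext' (S := ℂ) (s := Rel ℳ) f g (TensorAlgebra.hom_ext ?_)
  ext a
  exact h a

theorem induction {motive : SuperSym ℳ → Prop} (hc : ∀ c : ℂ, motive (algebraMap ℂ _ c))
    (hι : ∀ a : M, motive (ι ℳ a)) (hmul : ∀ f g, motive f → motive g → motive (f * g))
    (hadd : ∀ f g, motive f → motive g → motive (f + g)) (f : SuperSym ℳ) : motive f := by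
  obtain ⟨t, rfl⟩ := RingQuot.mkAlgHom_surjective ℂ (Rel ℳ) f
  induction t using TensorAlgebra.induction with
  | algebraMap c => rw [AlgHom.commutes]; exact hc c
  | ι a => exact hι a
  | mul a b ha hb => rw [map_mul]; exact hmul _ _ ha hb
  | add a b ha hb => rw [map_add]; exact hadd _ _ ha hb

/-- The algebra homomorphism `S(M) → S(N)` induced by an even linear map `M → N`. -/
def map {N : Type*} [AddCommGroup N] [Module ℂ N] (𝒩 : ZMod 2 → Submodule ℂ N)
    (f : M →ₗ[ℂ] N) (hf : ∀ i : ZMod 2, ∀ a ∈ ℳ i, f a ∈ 𝒩 i) : SuperSym ℳ →ₐ[ℂ] SuperSym 𝒩 :=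
  lift ℳ (ι 𝒩 ∘ₗ f) fun i j a ha b hb => ι_mul_ι 𝒩 (hf i a ha) (hf j b hb)

/-- The sign automorphism of `S(M)`: a homogeneous `f` of parity `i` goes to `(-1) ^ (p i) f`. -/
def twist [DirectSum.Decomposition ℳ] (p : ZMod 2) : SuperSym ℳ →ₐ[ℂ] SuperSym ℳ :=
  map ℳ ℳ (parityTwist ℳ p) fun i a ha => by
    rw [parityTwist_of_mem ℳ p ha]
    exact Submodule.smul_mem _ _ ha

/-- On generators, `a ↦ !![(-1) ^ (p |a|) a, T a; 0, a]`. -/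
def derMatrixAux [DirectSum.Decomposition ℳ] (p : ZMod 2) (T : M →ₗ[ℂ] M) :
    M →ₗ[ℂ] Matrix (Fin 2) (Fin 2) (SuperSym ℳ) where
  toFun a := !![ι ℳ (parityTwist ℳ p a), ι ℳ (T a); 0, ι ℳ a]
  map_add' a b := by
    ext i j; fin_cases i <;> fin_cases j <;> simp
  map_smul' c a := by
    ext i j; fin_cases i <;> fin_cases j <;> simp

/-- The algebra homomorphism `f ↦ !![(-1) ^ (p |f|) f, D f; 0, f]`, where `D` is the
superderivation of parity `p` extending `T`. -/
def derMatrix [DirectSum.Decomposition ℳ] (p : ZMod 2) (T : M →ₗ[ℂ] M)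
    (hT : ∀ i : ZMod 2, ∀ a ∈ ℳ i, T a ∈ ℳ (p + i)) :
    SuperSym ℳ →ₐ[ℂ] Matrix (Fin 2) (Fin 2) (SuperSym ℳ) :=
  lift ℳ (derMatrixAux ℳ p T) fun i j a ha b hb => by
    have h1 := ι_mul_ι ℳ ha hb
    have h2 := ι_mul_ι ℳ (hT i a ha) hb
    have h3 := ι_mul_ι ℳ ha (hT j b hb)
    change !![ι ℳ (parityTwist ℳ p a), ι ℳ (T a); 0, ι ℳ a] *
        !![ι ℳ (parityTwist ℳ p b), ι ℳ (T b); 0, ι ℳ b] =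
      superSign i j • (!![ι ℳ (parityTwist ℳ p b), ι ℳ (T b); 0, ι ℳ b] *
        !![ι ℳ (parityTwist ℳ p a), ι ℳ (T a); 0, ι ℳ a])
    rw [parityTwist_of_mem ℳ p ha, parityTwist_of_mem ℳ p hb]
    ext k l
    fin_cases k <;> fin_cases l
    · simp [h1, smul_smul, mul_comm, mul_left_comm]
    · simp only [Matrix.mul_fin_two, Matrix.smul_apply, map_smul, smul_mul_assoc]
      simp [h2, h3, smul_smul, superSign_add_left, superSign_mul_add_right, mul_comm,
        add_comm]
    · simp
    · simpa using h1

/-- The superderivation `D` of parity `p` of `S(M)` that extends a linear map `T : M → M` of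
parity `p`; see `superDer_ι` and `superDer_mul`. -/
def superDer [DirectSum.Decomposition ℳ] (p : ZMod 2) (T : M →ₗ[ℂ] M)
    (hT : ∀ i : ZMod 2, ∀ a ∈ ℳ i, T a ∈ ℳ (p + i)) : SuperSym ℳ →ₗ[ℂ] SuperSym ℳ where
  toFun f := derMatrix ℳ p T hT f 0 1
  map_add' f g := by simp
  map_smul' c f := by simp

theorem superDer_ι [DirectSum.Decomposition ℳ] (p : ZMod 2) (T : M →ₗ[ℂ] M)
    (hT : ∀ i : ZMod 2, ∀ a ∈ ℳ i, T a ∈ ℳ (p + i)) (a : M) :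
    superDer ℳ p T hT (ι ℳ a) = ι ℳ (T a) := by
  change derMatrix ℳ p T hT (ι ℳ a) 0 1 = _
  rw [derMatrix, lift_ι]
  rfl

theorem derMatrix_apply [DirectSum.Decomposition ℳ] (p : ZMod 2) (T : M →ₗ[ℂ] M)
    (hT : ∀ i : ZMod 2, ∀ a ∈ ℳ i, T a ∈ ℳ (p + i)) (f : SuperSym ℳ) :
    derMatrix ℳ p T hT f = !![twist ℳ p f, superDer ℳ p T hT f; 0, f] := by
  have key : derMatrix ℳ p T hT f 0 0 = twist ℳ p f ∧ derMatrix ℳ p T hT f 1 0 = 0 ∧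
      derMatrix ℳ p T hT f 1 1 = f := by
    refine induction ℳ (motive := fun f => derMatrix ℳ p T hT f 0 0 = twist ℳ p f ∧
      derMatrix ℳ p T hT f 1 0 = 0 ∧ derMatrix ℳ p T hT f 1 1 = f) ?_ ?_ ?_ ?_ f
    · intro c
      simp [Matrix.algebraMap_matrix_apply]
    · intro a
      have h : derMatrix ℳ p T hT (ι ℳ a) =
          !![ι ℳ (parityTwist ℳ p a), ι ℳ (T a); 0, ι ℳ a] := by
        rw [derMatrix, lift_ι]; rfl
      rw [h]
      simp [twist, map]
    · rintro f g ⟨h1, h2, h3⟩ ⟨k1, k2, k3⟩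
      simp [map_mul, Matrix.mul_apply, Fin.sum_univ_two, h1, h2, h3, k1, k2, k3]
    · rintro f g ⟨h1, h2, h3⟩ ⟨k1, k2, k3⟩
      simp [map_add, h1, h2, h3, k1, k2, k3]
  ext k l
  fin_cases k <;> fin_cases l
  · exact key.1
  · rfl
  · exact key.2.1
  · exact key.2.2

/-- The super Leibniz rule `D (f g) = D f g + (-1) ^ (p |f|) f D g`. -/
theorem superDer_mul [DirectSum.Decomposition ℳ] (p : ZMod 2) (T : M →ₗ[ℂ] M)
    (hT : ∀ i : ZMod 2, ∀ a ∈ ℳ i, T a ∈ ℳ (p + i)) (f g : SuperSym ℳ) :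
    superDer ℳ p T hT (f * g) =
      superDer ℳ p T hT f * g + twist ℳ p f * superDer ℳ p T hT g := by
  have h := congrFun (congrFun (map_mul (derMatrix ℳ p T hT) f g) 0) 1
  rw [derMatrix_apply ℳ p T hT f, derMatrix_apply ℳ p T hT g] at h
  rw [show superDer ℳ p T hT (f * g) = derMatrix ℳ p T hT (f * g) 0 1 from rfl, h]
  simp [Matrix.mul_apply, Fin.sum_univ_two, add_comm]

theorem superDer_algebraMap [DirectSum.Decomposition ℳ] (p : ZMod 2) (T : M →ₗ[ℂ] M)
    (hT : ∀ i : ZMod 2, ∀ a ∈ ℳ i, T a ∈ ℳ (p + i)) (c : ℂ) :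
    superDer ℳ p T hT (algebraMap ℂ _ c) = 0 := by
  change derMatrix ℳ p T hT (algebraMap ℂ _ c) 0 1 = 0
  simp [Matrix.algebraMap_matrix_apply]

end

end SuperSym

/-! ### Lie superalgebras and their modules -/

/-- A Lie superalgebra structure on the superspace `(𝔤, 𝒢)`. -/
structure LieSuperalgebra {𝔤 : Type*} [AddCommGroup 𝔤] [Module ℂ 𝔤]
    (𝒢 : ZMod 2 → Submodule ℂ 𝔤) [DirectSum.Decomposition 𝒢] where
  /-- The superbracket. -/
  bracket : 𝔤 →ₗ[ℂ] 𝔤 →ₗ[ℂ] 𝔤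
  bracket_mem : ∀ i j : ZMod 2, ∀ x ∈ 𝒢 i, ∀ y ∈ 𝒢 j, bracket x y ∈ 𝒢 (i + j)
  bracket_skew : ∀ i j : ZMod 2, ∀ x ∈ 𝒢 i, ∀ y ∈ 𝒢 j,
    bracket x y = -(superSign i j • bracket y x)
  jacobi : ∀ i j : ZMod 2, ∀ x ∈ 𝒢 i, ∀ y ∈ 𝒢 j, ∀ z : 𝔤,
    bracket x (bracket y z) = bracket (bracket x y) z + superSign i j • bracket y (bracket x z)

/-- A module structure on the superspace `(V, 𝒱)` over a Lie superalgebra: an even linear map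
`act : 𝔤 → End V` with `[x, y] v = x (y v) - (-1) ^ (|x| |y|) y (x v)`. -/
structure LieSuperalgebra.Rep {𝔤 : Type*} [AddCommGroup 𝔤] [Module ℂ 𝔤]
    {𝒢 : ZMod 2 → Submodule ℂ 𝔤} [DirectSum.Decomposition 𝒢] (A : LieSuperalgebra 𝒢)
    {V : Type*} [AddCommGroup V] [Module ℂ V]
    (𝒱 : ZMod 2 → Submodule ℂ V) [DirectSum.Decomposition 𝒱] where
  /-- The action. -/
  act : 𝔤 →ₗ[ℂ] V →ₗ[ℂ] V
  act_mem : ∀ i j : ZMod 2, ∀ x ∈ 𝒢 i, ∀ v ∈ 𝒱 j, act x v ∈ 𝒱 (i + j)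
  act_bracket : ∀ i j : ZMod 2, ∀ x ∈ 𝒢 i, ∀ y ∈ 𝒢 j, ∀ v : V,
    act (A.bracket x y) v = act x (act y v) - superSign i j • act y (act x v)

namespace LieSuperalgebra

section

variable {𝔤 : Type*} [AddCommGroup 𝔤] [Module ℂ 𝔤] {𝒢 : ZMod 2 → Submodule ℂ 𝔤}
  [DirectSum.Decomposition 𝒢] (A : LieSuperalgebra 𝒢)

/-- The adjoint representation. -/
def adjoint : A.Rep 𝒢 where
  act := A.bracket
  act_mem := A.bracket_mem
  act_bracket i j x hx y hy v := by
    rw [A.jacobi i j x hx y hy v, add_sub_cancel_right]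

variable {A} {V : Type*} [AddCommGroup V] [Module ℂ V] {𝒱 : ZMod 2 → Submodule ℂ V}
  [DirectSum.Decomposition 𝒱] (ρ : A.Rep 𝒱)

/-- The action on `V*` of an element `x` of parity `p`:
`(x α) v = - (-1) ^ (p |α|) α (x v)`. -/
def Rep.dualAct (p : ZMod 2) (x : 𝔤) : Module.Dual ℂ V →ₗ[ℂ] Module.Dual ℂ V :=
  -((ρ.act x).dualMap ∘ₗ parityTwist (dualGrading 𝒱) p)

theorem Rep.dualAct_apply {p : ZMod 2} (x : 𝔤) {i : ZMod 2} {α : Module.Dual ℂ V}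
    (hα : α ∈ dualGrading 𝒱 i) (v : V) :
    ρ.dualAct p x α v = -(superSign p i * α (ρ.act x v)) := by
  simp [Rep.dualAct, parityTwist_of_mem _ p hα]

theorem Rep.dualAct_mem {p : ZMod 2} {x : 𝔤} (hx : x ∈ 𝒢 p) (i : ZMod 2)
    (α : Module.Dual ℂ V) (hα : α ∈ dualGrading 𝒱 i) :
    ρ.dualAct p x α ∈ dualGrading 𝒱 (p + i) := by
  refine (Submodule.mem_dualAnnihilator _).2 fun v hv => ?_
  rw [ρ.dualAct_apply x hα]
  have h := ρ.act_mem p (p + i + 1) x hx v hv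
  have hp : ∀ p i : ZMod 2, p + (p + i + 1) = i + 1 := by decide
  rw [hp] at h
  rw [(Submodule.mem_dualAnnihilator _).1 hα _ h, mul_zero, neg_zero]

/-- The action on `S(V*)` of an element `x` of parity `p`, by the superderivation extending its
action on `V*`. -/
def Rep.polyAct {p : ZMod 2} {x : 𝔤} (hx : x ∈ 𝒢 p) :
    SuperSym (dualGrading 𝒱) →ₗ[ℂ] SuperSym (dualGrading 𝒱) :=
  SuperSym.superDer (dualGrading 𝒱) p (ρ.dualAct p x) (ρ.dualAct_mem hx)

/-- The algebra `S(V*)^𝔤` of invariant polynomials: those killed by all homogeneous elements of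
`𝔤` (hence, extending the action by linearity, by all of `𝔤`). -/
def Rep.invariants : Subalgebra ℂ (SuperSym (dualGrading 𝒱)) where
  carrier := {f | ∀ (p : ZMod 2) (x : 𝔤) (hx : x ∈ 𝒢 p), ρ.polyAct hx f = 0}
  mul_mem' {f g} hf hg p x hx := by
    have h1 := hf p x hx
    have h2 := hg p x hx
    rw [Rep.polyAct] at h1 h2 ⊢
    rw [SuperSym.superDer_mul, h1, h2, zero_mul, mul_zero, add_zero]
  add_mem' {f g} hf hg p x hx := by
    rw [map_add, hf p x hx, hg p x hx, add_zero]
  algebraMap_mem' c p x hx := SuperSym.superDer_algebraMap _ _ _ _ c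

end

end LieSuperalgebra

/-- The restriction of polynomials `S(V*) → S(L*)`, induced by the restriction of linear forms. -/
def restrictPoly {V : Type*} [AddCommGroup V] [Module ℂ V] (𝒱 : ZMod 2 → Submodule ℂ V)
    (L : Submodule ℂ V) :
    SuperSym (dualGrading 𝒱) →ₐ[ℂ] SuperSym (dualGrading (subGrading 𝒱 L)) :=
  SuperSym.map (dualGrading 𝒱) (dualGrading (subGrading 𝒱 L)) L.dualRestrict fun i α hα => by
    refine (Submodule.mem_dualAnnihilator _).2 fun v hv => ?_
    exact (Submodule.mem_dualAnnihilator _).1 hα v hv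

/-! ### Cartan subalgebras -/

namespace LieSuperalgebra

section

variable {𝔤 : Type*} [AddCommGroup 𝔤] [Module ℂ 𝔤] {𝒢 : ZMod 2 → Submodule ℂ 𝔤}
  [DirectSum.Decomposition 𝒢] (A : LieSuperalgebra 𝒢)

/-- The lower central series `𝔥 ⊇ [𝔥, 𝔥] ⊇ [𝔥, [𝔥, 𝔥]] ⊇ ...` of a subalgebra `𝔥`. -/
def lowerCentral (𝔥 : Submodule ℂ 𝔤) : ℕ → Submodule ℂ 𝔤
  | 0 => 𝔥
  | k + 1 => Submodule.map₂ A.bracket 𝔥 (lowerCentral 𝔥 k)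

/-- A Cartan subalgebra of a Lie superalgebra: a nilpotent subsuperalgebra which is equal to its
own normalizer. -/
structure IsCartan (𝔥 : Submodule ℂ 𝔤) : Prop where
  subsuperspace : IsSubsuperspace 𝒢 𝔥
  bracket_mem : ∀ x ∈ 𝔥, ∀ y ∈ 𝔥, A.bracket x y ∈ 𝔥
  nilpotent : ∃ k : ℕ, A.lowerCentral 𝔥 k = ⊥
  self_normalizing : ∀ x : 𝔤, (∀ y ∈ 𝔥, A.bracket x y ∈ 𝔥) → x ∈ 𝔥

end

end LieSuperalgebra

end

noncomputable section

open scoped Polynomial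

/-! For the proposition, expand an invariant `f` at `w₀` by the substitution `α ↦ X α + α(w₀)`, and
let `fₙ` be the coefficient of `Xⁿ`. A vector field `x` splits at `w₀` into its linear part and a
constant field, which is `x w₀` up to sign. Comparing coefficients in `x f = 0` shows that the
linear part applied to `fₙ` plus the constant field applied to `fₙ₊₁` is zero
(`coeff_taylor_superDer`). By induction on `n` every `fₙ` vanishes: if `fₙ = 0`, then `fₙ₊₁` is
killed by all constant fields along `𝔤 w₀`, and it restricts to zero on `L` because `w₀ ∈ L`.

Such a polynomial is zero (`Rep.eq_zero_of_contract_eq_zero`). Choose an even projection `q` of `V`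
with kernel `L` and image in `𝔤 w₀`. The Euler operator of `q` is a combination of the constant
fields, so it kills the polynomial. In characteristic zero the polynomial is then its own pullback
along `1 - q`, which takes values in `L`.

The corollary needs an even `w₀ ∈ 𝔥` with `[𝔤, w₀] + 𝔥 = 𝔤`. Decompose `𝔤` into generalized weight
spaces of the nilpotent Lie algebra `𝔥₀` and take `w₀` outside the kernels of the nonzero weights:
`ad w₀` is then onto each nonzero weight space. The zero weight space lies in `𝔥` by an Engel-type
argument (`le_of_locally_nilpotent`), where the odd elements are controlled by `(ad c)² = ½ ad [c,
c]`. -/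

theorem superSign_zero_left (j : ZMod 2) : superSign 0 j = 1 := by
  simp [superSign]

theorem superSign_symm (i j : ZMod 2) : superSign i j = superSign j i := by
  simp [superSign, mul_comm]

theorem superSign_mul_self (i j : ZMod 2) : superSign i j * superSign i j = 1 := by
  have h : ∀ i j : ZMod 2, (-1 : ℤ) ^ (i.val * j.val) * (-1) ^ (i.val * j.val) = 1 := by decide
  unfold superSign
  exact_mod_cast h i j

theorem sum_decompose {M : Type*} [AddCommGroup M] [Module ℂ M] (ℳ : ZMod 2 → Submodule ℂ M)
    [DirectSum.Decomposition ℳ] (a : M) :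
    ∑ i : ZMod 2, (DirectSum.decompose ℳ a i : M) = a := by
  classical
  conv_rhs => rw [← DirectSum.sum_support_decompose ℳ a]
  refine (Finset.sum_subset (Finset.subset_univ _) fun i _ hi => ?_).symm
  simpa using hi

theorem parityTwist_zero {M : Type*} [AddCommGroup M] [Module ℂ M] (ℳ : ZMod 2 → Submodule ℂ M)
    [DirectSum.Decomposition ℳ] (a : M) : parityTwist ℳ 0 a = a := by
  change ∑ i : ZMod 2, superSign 0 i • (DirectSum.decompose ℳ a i : M) = a
  simp only [superSign_zero_left, one_smul]
  exact sum_decompose ℳ a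

/-- Linear maps which agree on homogeneous vectors are equal. -/
theorem linearMap_ext_of_homogeneous {M N : Type*} [AddCommGroup M] [Module ℂ M]
    [AddCommGroup N] [Module ℂ N] (ℳ : ZMod 2 → Submodule ℂ M) [DirectSum.Decomposition ℳ]
    {f g : M →ₗ[ℂ] N} (h : ∀ i, ∀ a ∈ ℳ i, f a = g a) : f = g := by
  ext a
  rw [← sum_decompose ℳ a, map_sum, map_sum]
  exact Finset.sum_congr rfl fun i _ => h i _ (SetLike.coe_mem _)

/-! ### Homomorphisms into `S(M)[X]`: scaling and Taylor expansion. -/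

/-- Evaluation of polynomials over a noncommutative algebra at a scalar. -/
def Polynomial.evalScalar {B : Type*} [Ring B] [Algebra ℂ B] (c : ℂ) : B[X] →ₐ[ℂ] B where
  -- Multiplicativity over a noncommutative `B` needs the point of evaluation to be central, as
  -- scalars are.
  __ := Polynomial.eval₂RingHom' (RingHom.id B) (algebraMap ℂ B c)
    fun b => (Algebra.commutes c b).symm
  commutes' r := by
    change Polynomial.eval₂ (RingHom.id B) (algebraMap ℂ B c) (algebraMap ℂ B[X] r) = _
    rw [Polynomial.algebraMap_apply, Polynomial.eval₂_C]
    rfl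

theorem Polynomial.evalScalar_C {B : Type*} [Ring B] [Algebra ℂ B] (c : ℂ) (b : B) :
    Polynomial.evalScalar c (Polynomial.C b) = b :=
  Polynomial.eval₂_C _ _

theorem Polynomial.evalScalar_X {B : Type*} [Ring B] [Algebra ℂ B] (c : ℂ) :
    Polynomial.evalScalar c (Polynomial.X : B[X]) = algebraMap ℂ B c :=
  Polynomial.eval₂_X _ _

namespace SuperSym

section

variable {M : Type*} [AddCommGroup M] [Module ℂ M] (ℳ : ZMod 2 → Submodule ℂ M)

@[simp]
theorem map_ι {N : Type*} [AddCommGroup N] [Module ℂ N] (𝒩 : ZMod 2 → Submodule ℂ N)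
    (f : M →ₗ[ℂ] N) (hf : ∀ i : ZMod 2, ∀ a ∈ ℳ i, f a ∈ 𝒩 i) (a : M) :
    map ℳ 𝒩 f hf (ι ℳ a) = ι 𝒩 (f a) := by
  simp [map]

/-- Two superderivations along algebra homomorphisms agree if they agree on generators. -/
theorem eq_of_leibniz {B : Type*} [Ring B] [Algebra ℂ B] (φ ψ : SuperSym ℳ →ₐ[ℂ] B)
    {D D' : SuperSym ℳ →ₗ[ℂ] B} (hD : ∀ f g, D (f * g) = D f * φ g + ψ f * D g)
    (hD' : ∀ f g, D' (f * g) = D' f * φ g + ψ f * D' g)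
    (h : ∀ a, D (ι ℳ a) = D' (ι ℳ a)) : D = D' := by
  ext f
  have one : ∀ E : SuperSym ℳ →ₗ[ℂ] B, (∀ f g, E (f * g) = E f * φ g + ψ f * E g) →
      E 1 = 0 := fun E hE => by
    have := hE 1 1
    simpa using this
  induction f using SuperSym.induction with
  | hc c =>
    rw [Algebra.algebraMap_eq_smul_one, map_smul, map_smul, one D hD, one D' hD']
  | hι a => exact h a
  | hmul f g hf hg => rw [hD, hD', hf, hg]
  | hadd f g hf hg => rw [map_add, map_add, hf, hg]

/-- The homomorphism `S(M) → S(M)[X]` which scales the image of `1 - π` by `1` and that of `π`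
by `X`. -/
def scaleAlong (π : M →ₗ[ℂ] M) (hπ : ∀ i, ∀ a ∈ ℳ i, π a ∈ ℳ i) :
    SuperSym ℳ →ₐ[ℂ] (SuperSym ℳ)[X] :=
  lift ℳ
    { toFun := fun a => Polynomial.C (ι ℳ (a - π a)) + Polynomial.X * Polynomial.C (ι ℳ (π a))
      map_add' := fun a b => by simp only [map_add, map_sub, mul_add]; abel
      map_smul' := fun c a => by
        simp only [map_smul, ← smul_sub, ← Polynomial.smul_C, mul_smul_comm, smul_add,
          RingHom.id_apply] }
    fun i j a ha b hb => by
      -- As `π` is even, `a - π a` and `π a` both keep the parity of `a`; the four products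
      -- therefore exchange with the same sign.
      have ha' := Submodule.sub_mem _ ha (hπ i a ha)
      have hb' := Submodule.sub_mem _ hb (hπ j b hb)
      have h1 := congrArg Polynomial.C (ι_mul_ι ℳ ha' hb')
      have h2 := congrArg Polynomial.C (ι_mul_ι ℳ ha' (hπ j b hb))
      have h3 := congrArg Polynomial.C (ι_mul_ι ℳ (hπ i a ha) hb')
      have h4 := congrArg Polynomial.C (ι_mul_ι ℳ (hπ i a ha) (hπ j b hb))
      simp only [map_mul, ← Polynomial.smul_C] at h1 h2 h3 h4
      change (Polynomial.C (ι ℳ (a - π a)) + Polynomial.X * Polynomial.C (ι ℳ (π a))) *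
        (Polynomial.C (ι ℳ (b - π b)) + Polynomial.X * Polynomial.C (ι ℳ (π b))) =
        superSign i j • ((Polynomial.C (ι ℳ (b - π b)) + Polynomial.X * Polynomial.C (ι ℳ (π b))) *
        (Polynomial.C (ι ℳ (a - π a)) + Polynomial.X * Polynomial.C (ι ℳ (π a))))
      have comm (x : SuperSym ℳ) (y : (SuperSym ℳ)[X]) : Polynomial.C x * (Polynomial.X * y) =
          Polynomial.X * (Polynomial.C x * y) := by
        rw [← mul_assoc, ← Polynomial.X_mul_C, mul_assoc]
      simp only [add_mul, mul_add, mul_assoc, comm, h1, h2, h3, h4, mul_smul_comm, smul_add]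
      abel

theorem scaleAlong_ι (π : M →ₗ[ℂ] M) (hπ : ∀ i, ∀ a ∈ ℳ i, π a ∈ ℳ i) (a : M) :
    scaleAlong ℳ π hπ (ι ℳ a) =
      Polynomial.C (ι ℳ (a - π a)) + Polynomial.X * Polynomial.C (ι ℳ (π a)) := by
  rw [scaleAlong, lift_ι]
  rfl

/-- Either `a` is even and the sign is `1`, or `a` is odd and `ε a = 0`. This makes evaluation at an
even point compatible with supercommutativity. -/
theorem superSign_mul_even (ε : M →ₗ[ℂ] ℂ) (hε : ∀ a ∈ ℳ 1, ε a = 0) {i : ZMod 2} (j : ZMod 2) {a : M} (ha : a ∈ ℳ i) :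
    superSign i j * ε a = ε a := by
  have : ∀ i : ZMod 2, i = 0 ∨ i = 1 := by decide
  rcases this i with rfl | rfl
  · rw [superSign_zero_left, one_mul]
  · rw [hε a ha, mul_zero]

/-- Taylor expansion at the point `ε`: the homomorphism `a ↦ X a + ε(a)`. -/
def taylor (ε : M →ₗ[ℂ] ℂ) (hε : ∀ a ∈ ℳ 1, ε a = 0) : SuperSym ℳ →ₐ[ℂ] (SuperSym ℳ)[X] :=
  lift ℳ
    { toFun := fun a => Polynomial.X * Polynomial.C (ι ℳ a) + algebraMap ℂ _ (ε a)
      map_add' := fun a b => by simp only [map_add, mul_add]; abel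
      map_smul' := fun c a => by
        simp only [map_smul, ← Polynomial.smul_C, mul_smul_comm, smul_add, RingHom.id_apply,
          Algebra.algebraMap_eq_smul_one, smul_smul, smul_eq_mul] }
    fun i j a ha b hb => by
      have h1 := congrArg Polynomial.C (ι_mul_ι ℳ ha hb)
      simp only [map_mul, ← Polynomial.smul_C] at h1
      have h2 := superSign_mul_even ℳ ε hε j ha
      have h3 := superSign_mul_even ℳ ε hε i hb
      rw [superSign_symm] at h3
      change (Polynomial.X * Polynomial.C (ι ℳ a) + algebraMap ℂ _ (ε a)) *
        (Polynomial.X * Polynomial.C (ι ℳ b) + algebraMap ℂ _ (ε b)) =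
        superSign i j • ((Polynomial.X * Polynomial.C (ι ℳ b) + algebraMap ℂ _ (ε b)) *
        (Polynomial.X * Polynomial.C (ι ℳ a) + algebraMap ℂ _ (ε a)))
      have comm (x : SuperSym ℳ) (y : (SuperSym ℳ)[X]) : Polynomial.C x * (Polynomial.X * y) =
          Polynomial.X * (Polynomial.C x * y) := by
        rw [← mul_assoc, ← Polynomial.X_mul_C, mul_assoc]
      simp only [Algebra.algebraMap_eq_smul_one, add_mul, mul_add, mul_assoc, comm, h1,
        mul_smul_comm, smul_mul_assoc, smul_add, smul_smul, one_mul, mul_one, h2, h3]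
      rw [← mul_assoc (superSign i j), h2, mul_comm (ε b)]
      abel

theorem taylor_ι (ε : M →ₗ[ℂ] ℂ) (hε : ∀ a ∈ ℳ 1, ε a = 0) (a : M) : taylor ℳ ε hε (ι ℳ a) =
    Polynomial.X * Polynomial.C (ι ℳ a) + algebraMap ℂ _ (ε a) := by
  rw [taylor, lift_ι]
  rfl

/-- At `X = 1` the expansion becomes the translation `a ↦ a + ε(a)`, which the translation by `-ε`
inverts. -/
theorem taylor_injective (ε : M →ₗ[ℂ] ℂ) (hε : ∀ a ∈ ℳ 1, ε a = 0) : Function.Injective (taylor ℳ ε hε) := by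
  let back : SuperSym ℳ →ₐ[ℂ] SuperSym ℳ :=
    (Polynomial.evalScalar 1).comp (taylor ℳ (-ε) fun a ha => by simp [hε a ha])
  have h : (back.comp (Polynomial.evalScalar 1)).comp (taylor ℳ ε hε) = AlgHom.id ℂ _ :=
    algHom_ext fun a => by
      simp [back, taylor_ι, Polynomial.evalScalar_C, Polynomial.evalScalar_X]
  intro f g hfg
  rw [← AlgHom.id_apply (R := ℂ) f, ← AlgHom.id_apply (R := ℂ) g, ← h, AlgHom.comp_apply, hfg]
  rfl

variable [DirectSum.Decomposition ℳ]

theorem twist_ι_of_mem (p : ZMod 2) {i : ZMod 2} {a : M} (ha : a ∈ ℳ i) :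
    twist ℳ p (ι ℳ a) = superSign p i • ι ℳ a := by
  rw [twist, map_ι, parityTwist_of_mem ℳ p ha, map_smul]

theorem twist_zero (f : SuperSym ℳ) : twist ℳ 0 f = f := by
  have : twist ℳ 0 = AlgHom.id ℂ _ := algHom_ext fun a => by
    simp [twist, parityTwist_zero]
  rw [this, AlgHom.id_apply]

theorem algHom_ext_of_homogeneous {A : Type*} [Ring A] [Algebra ℂ A] {f g : SuperSym ℳ →ₐ[ℂ] A}
    (h : ∀ i, ∀ a ∈ ℳ i, f (ι ℳ a) = g (ι ℳ a)) : f = g := by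
  refine algHom_ext fun a => ?_
  exact LinearMap.congr_fun (linearMap_ext_of_homogeneous ℳ
    (f := f.toLinearMap ∘ₗ ι ℳ) (g := g.toLinearMap ∘ₗ ι ℳ) h) a

/-- A homogeneous generator supercommutes with every element. -/
theorem ι_mul_twist {p : ZMod 2} {a : M} (ha : a ∈ ℳ p) (f : SuperSym ℳ) :
    ι ℳ a * twist ℳ p f = f * ι ℳ a := by
  induction f using SuperSym.induction with
  | hc c => rw [AlgHom.commutes]; exact (Algebra.commutes c _).symm
  | hι b =>
    refine LinearMap.congr_fun (linearMap_ext_of_homogeneous ℳ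
      (f := LinearMap.mulLeft ℂ (ι ℳ a) ∘ₗ (twist ℳ p).toLinearMap ∘ₗ ι ℳ)
      (g := LinearMap.mulRight ℂ (ι ℳ a) ∘ₗ ι ℳ) fun i b hb => ?_) b
    simp [twist_ι_of_mem ℳ p hb, ι_mul_ι ℳ ha hb, smul_smul, superSign_mul_self]
  | hmul f g hf hg => rw [map_mul, ← mul_assoc, hf, mul_assoc, hg, mul_assoc]
  | hadd f g hf hg => rw [map_add, mul_add, hf, hg, add_mul]

/-! ### Superderivations with constant coefficients. -/

/-- The algebra homomorphism `f ↦ !![(-1) ^ (p |f|) f, D f; 0, f]`, where `D` is the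
superderivation of parity `p` extending a linear form `δ` of parity `p`. -/
def contractMatrix (p : ZMod 2) (δ : M →ₗ[ℂ] ℂ) (hδ : ∀ i, ∀ a ∈ ℳ i, i ≠ p → δ a = 0) :
    SuperSym ℳ →ₐ[ℂ] Matrix (Fin 2) (Fin 2) (SuperSym ℳ) :=
  lift ℳ
    { toFun := fun a => !![ι ℳ (parityTwist ℳ p a), algebraMap ℂ _ (δ a); 0, ι ℳ a]
      map_add' := fun a b => by ext i j; fin_cases i <;> fin_cases j <;> simp
      map_smul' := fun c a => by
        ext i j; fin_cases i <;> fin_cases j <;> simp [Algebra.smul_def] }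
    fun i j a ha b hb => by
      have h1 := ι_mul_ι ℳ ha hb
      change !![ι ℳ (parityTwist ℳ p a), algebraMap ℂ _ (δ a); 0, ι ℳ a] *
          !![ι ℳ (parityTwist ℳ p b), algebraMap ℂ _ (δ b); 0, ι ℳ b] =
        superSign i j • (!![ι ℳ (parityTwist ℳ p b), algebraMap ℂ _ (δ b); 0, ι ℳ b] *
          !![ι ℳ (parityTwist ℳ p a), algebraMap ℂ _ (δ a); 0, ι ℳ a])
      rw [parityTwist_of_mem ℳ p ha, parityTwist_of_mem ℳ p hb]
      -- For the upper right entry: `δ` sees only parity `p`, so the sign for moving the derivation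
      -- past one factor equals the sign for exchanging `a` and `b` whenever the term is nonzero.
      have h2 : superSign p i * δ b = superSign i j * δ b := by
        rcases eq_or_ne j p with rfl | h
        · rw [superSign_symm]
        · rw [hδ j b hb h, mul_zero, mul_zero]
      have h3 : δ a = superSign i j * (superSign p j * δ a) := by
        rcases eq_or_ne i p with rfl | h
        · rw [← mul_assoc, superSign_mul_self, one_mul]
        · rw [hδ i a ha h, mul_zero, mul_zero]
      ext k l
      fin_cases k <;> fin_cases l
      · simp [h1, smul_smul, mul_comm, mul_left_comm]
      · simp only [Algebra.algebraMap_eq_smul_one]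
        simp only [Matrix.smul_apply, Matrix.mul_apply, Fin.sum_univ_two, map_smul]
        simp only [Fin.zero_eta, Fin.mk_one, Matrix.of_apply, Matrix.cons_val', Matrix.cons_val_zero,
          Matrix.cons_val_one, Matrix.cons_val_fin_one, smul_mul_assoc, mul_smul_comm, one_mul,
          mul_one, smul_add, smul_smul]
        rw [mul_comm (δ b), h2, ← mul_assoc, add_comm]
        congr 2
        rw [mul_assoc, mul_comm (δ a), ← h3]
      · simp
      · simpa using h1

/-- The superderivation of parity `p` of `S(M)` that extends a linear form of parity `p`. -/
def contract (p : ZMod 2) (δ : M →ₗ[ℂ] ℂ) (hδ : ∀ i, ∀ a ∈ ℳ i, i ≠ p → δ a = 0) :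
    SuperSym ℳ →ₗ[ℂ] SuperSym ℳ where
  toFun f := contractMatrix ℳ p δ hδ f 0 1
  map_add' f g := by simp
  map_smul' c f := by simp

variable (p : ZMod 2) (δ : M →ₗ[ℂ] ℂ) (hδ : ∀ i, ∀ a ∈ ℳ i, i ≠ p → δ a = 0)

theorem contractMatrix_ι (a : M) : contractMatrix ℳ p δ hδ (ι ℳ a) =
    !![ι ℳ (parityTwist ℳ p a), algebraMap ℂ _ (δ a); 0, ι ℳ a] := by
  rw [contractMatrix, lift_ι]
  rfl

theorem contract_ι (a : M) : contract ℳ p δ hδ (ι ℳ a) = algebraMap ℂ _ (δ a) := by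
  change contractMatrix ℳ p δ hδ (ι ℳ a) 0 1 = _
  rw [contractMatrix_ι]
  rfl

theorem contract_mul (f g : SuperSym ℳ) : contract ℳ p δ hδ (f * g) =
    contract ℳ p δ hδ f * g + twist ℳ p f * contract ℳ p δ hδ g := by
  have key (f : SuperSym ℳ) : contractMatrix ℳ p δ hδ f 0 0 = twist ℳ p f ∧
      contractMatrix ℳ p δ hδ f 1 1 = f := by
    have key' : contractMatrix ℳ p δ hδ f 0 0 = twist ℳ p f ∧
        contractMatrix ℳ p δ hδ f 1 0 = 0 ∧ contractMatrix ℳ p δ hδ f 1 1 = f := by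
      induction f using SuperSym.induction with
      | hc c => simp [Matrix.algebraMap_matrix_apply]
      | hι a => rw [contractMatrix_ι]; simp [twist]
      | hmul f g hf hg =>
        obtain ⟨h1, h2, h3⟩ := hf
        obtain ⟨k1, k2, k3⟩ := hg
        simp [map_mul, Matrix.mul_apply, Fin.sum_univ_two, h1, h2, h3, k1, k2, k3]
      | hadd f g hf hg =>
        obtain ⟨h1, h2, h3⟩ := hf
        obtain ⟨k1, k2, k3⟩ := hg
        simp [map_add, h1, h2, h3, k1, k2, k3]
    exact ⟨key'.1, key'.2.2⟩
  change contractMatrix ℳ p δ hδ (f * g) 0 1 =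
    contractMatrix ℳ p δ hδ f 0 1 * g + twist ℳ p f * contractMatrix ℳ p δ hδ g 0 1
  rw [map_mul, Matrix.mul_apply, Fin.sum_univ_two, (key f).1, (key g).2, add_comm]

theorem contract_algebraMap (c : ℂ) : contract ℳ p δ hδ (algebraMap ℂ _ c) = 0 := by
  change contractMatrix ℳ p δ hδ (algebraMap ℂ _ c) 0 1 = 0
  simp [Matrix.algebraMap_matrix_apply]

/-! ### Elements killed by an Euler operator -/

/-- An element killed by the Euler operator of an even projection `π` comes from the image of
`1 - π`. -/
theorem eq_map_of_superDer_eq_zero (π : M →ₗ[ℂ] M) (hπ : ∀ i, ∀ a ∈ ℳ i, π a ∈ ℳ (0 + i))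
    (hidem : ∀ a, π (π a) = π a) (σ : M →ₗ[ℂ] M) (hσ : ∀ i, ∀ a ∈ ℳ i, σ a ∈ ℳ i)
    (hσπ : ∀ a, σ a = a - π a) {f : SuperSym ℳ}
    (hf : superDer ℳ 0 π hπ f = 0) : map ℳ ℳ σ hσ f = f := by
  have hπ' : ∀ i, ∀ a ∈ ℳ i, π a ∈ ℳ i := fun i a ha => by simpa using hπ i a ha
  set Φ := scaleAlong ℳ π hπ' with hΦ
  -- `X d/dX` of the scaled polynomial computes the Euler operator: both sides are derivations along
  -- `Φ`, and `π² = π` makes them agree on generators.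
  have hder : (LinearMap.mulLeft ℂ (Polynomial.X : (SuperSym ℳ)[X])) ∘ₗ
      (Polynomial.derivative.restrictScalars ℂ) ∘ₗ Φ.toLinearMap =
      Φ.toLinearMap ∘ₗ superDer ℳ 0 π hπ := by
    refine eq_of_leibniz ℳ Φ Φ (fun f g => ?_) (fun f g => ?_) fun a => ?_
    · simp only [LinearMap.comp_apply, AlgHom.toLinearMap_apply, map_mul,
        LinearMap.restrictScalars_apply, LinearMap.mulLeft_apply, Polynomial.derivative_mul,
        mul_add]
      rw [← mul_assoc, ← mul_assoc, ← mul_assoc, Polynomial.X_mul (p := Φ f)]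
    · simp [superDer_mul, twist_zero]
    · simp [superDer_ι, hΦ, scaleAlong_ι, hidem]
  have hconst : ∀ n, (Φ f).coeff (n + 1) = 0 := fun n => by
    have h := congrArg (fun q => Polynomial.coeff q (n + 1)) (LinearMap.congr_fun hder f)
    simp only [LinearMap.comp_apply, AlgHom.toLinearMap_apply, LinearMap.restrictScalars_apply,
      LinearMap.mulLeft_apply, hf, map_zero, Polynomial.coeff_X_mul, Polynomial.coeff_derivative,
      Polynomial.coeff_zero] at h
    have h' : ((n : ℂ) + 1) • (Φ f).coeff (n + 1) = 0 := by
      rw [← h, Algebra.smul_def, map_add, map_natCast, map_one]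
      exact ((Nat.cast_commute n _).add_left (Commute.one_left _)).eq
    exact (smul_eq_zero.1 h').resolve_left (Nat.cast_add_one_ne_zero n)
  have hC : Φ f = Polynomial.C ((Φ f).coeff 0) := by
    ext n
    cases n with
    | zero => simp
    | succ n => rw [hconst, Polynomial.coeff_C_succ]
  -- `Φ f` is constant in `X`, so its values at `0` and `1` coincide; these are the image of `f`
  -- under `σ` and `f` itself.
  have h0 : (Polynomial.evalScalar 0).comp Φ = map ℳ ℳ σ hσ := algHom_ext fun a => by
    simp [hΦ, scaleAlong_ι, Polynomial.evalScalar_C, Polynomial.evalScalar_X, hσπ]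
  have h1 : (Polynomial.evalScalar 1).comp Φ = AlgHom.id ℂ _ := algHom_ext fun a => by
    simp [hΦ, scaleAlong_ι, Polynomial.evalScalar_C, Polynomial.evalScalar_X]
  rw [← h0, AlgHom.comp_apply, hC, Polynomial.evalScalar_C]
  conv_rhs => rw [← AlgHom.id_apply (R := ℂ) f, ← h1, AlgHom.comp_apply, hC,
    Polynomial.evalScalar_C]

/-- The superderivation extending `∑ δ j ⊗ y j` is `∑ y j * ∂ (δ j)`. -/
theorem superDer_zero_eq_sum {κ : Type*} [Fintype κ] (π : M →ₗ[ℂ] M)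
    (hπ : ∀ i, ∀ a ∈ ℳ i, π a ∈ ℳ (0 + i)) (q : κ → ZMod 2) (δ : κ → M →ₗ[ℂ] ℂ)
    (hδ : ∀ k i, ∀ a ∈ ℳ i, i ≠ q k → δ k a = 0) (y : κ → M) (hy : ∀ k, y k ∈ ℳ (q k))
    (hsum : ∀ a, π a = ∑ k, δ k a • y k) (f : SuperSym ℳ) :
    superDer ℳ 0 π hπ f = ∑ k, ι ℳ (y k) * contract ℳ (q k) (δ k) (hδ k) f := by
  have h : superDer ℳ 0 π hπ =
      ∑ k, LinearMap.mulLeft ℂ (ι ℳ (y k)) ∘ₗ contract ℳ (q k) (δ k) (hδ k) := by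
    refine eq_of_leibniz ℳ (AlgHom.id ℂ _) (AlgHom.id ℂ _) (fun f g => ?_) (fun f g => ?_)
      fun a => ?_
    · simp [superDer_mul, twist_zero]
    · simp only [LinearMap.sum_apply, LinearMap.comp_apply, LinearMap.mulLeft_apply, contract_mul,
        AlgHom.id_apply, mul_add, Finset.sum_add_distrib, Finset.sum_mul, Finset.mul_sum,
        mul_assoc]
      -- Moving `f` to the left of `y k` cancels the twist, since `y k` and the contraction have the
      -- same parity; each summand is thus an even derivation.
      simp only [← mul_assoc, ι_mul_twist ℳ (hy _)]
    · simp only [superDer_ι, LinearMap.sum_apply, LinearMap.comp_apply, LinearMap.mulLeft_apply,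
        contract_ι, hsum, map_sum, map_smul]
      refine Finset.sum_congr rfl fun k _ => ?_
      rw [← Algebra.commutes, Algebra.smul_def]
  rw [h]
  simp

/-! ### Taylor expansion at an even point -/

section

variable (ε : M →ₗ[ℂ] ℂ)

/-- The evaluation term survives only on even generators, which the twist fixes. -/
theorem coeff_taylor_twist (hε : ∀ a ∈ ℳ 1, ε a = 0) (p : ZMod 2) (n : ℕ) (f : SuperSym ℳ) :
    (taylor ℳ ε hε (twist ℳ p f)).coeff n = twist ℳ p ((taylor ℳ ε hε f).coeff n) := by
  have h : (taylor ℳ ε hε).comp (twist ℳ p) =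
      (Polynomial.mapAlgHom (twist ℳ p)).comp (taylor ℳ ε hε) :=
    algHom_ext_of_homogeneous ℳ fun i a ha => by
      simp only [AlgHom.comp_apply, twist_ι_of_mem ℳ p ha, map_smul, taylor_ι, map_add, map_mul]
      have h2 := superSign_mul_even ℳ ε hε p ha
      rw [superSign_symm] at h2
      rw [AlgHom.commutes, smul_add, Algebra.algebraMap_eq_smul_one, smul_smul, h2]
      congr 1
      simp [twist_ι_of_mem ℳ p ha, ← Polynomial.smul_C]
  have h' := congrArg (fun q => Polynomial.coeff q n) (AlgHom.congr_fun h f)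
  simpa using h'

/-- Taylor expansion of a superderivation: its linear part acts on the coefficients, and its value
at the point contracts them. -/
theorem coeff_taylor_superDer (hε : ∀ a ∈ ℳ 1, ε a = 0) (p : ZMod 2) (T : M →ₗ[ℂ] M)
    (hT : ∀ i : ZMod 2, ∀ a ∈ ℳ i, T a ∈ ℳ (p + i)) (δ : M →ₗ[ℂ] ℂ)
    (hδ : ∀ i, ∀ a ∈ ℳ i, i ≠ p → δ a = 0) (hδT : ∀ a, δ a = ε (T a)) (f : SuperSym ℳ) :
    contract ℳ p δ hδ ((taylor ℳ ε hε f).coeff 0) = 0 ∧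
    ∀ n, (taylor ℳ ε hε (superDer ℳ p T hT f)).coeff n =
      superDer ℳ p T hT ((taylor ℳ ε hε f).coeff n) +
      contract ℳ p δ hδ ((taylor ℳ ε hε f).coeff (n + 1)) := by
  induction f using SuperSym.induction with
  | hc c =>
    refine ⟨?_, fun n => ?_⟩
    · simp [Polynomial.algebraMap_apply, contract_algebraMap]
    · cases n <;>
      simp [Polynomial.algebraMap_apply, superDer_algebraMap]
  | hι a =>
    refine ⟨?_, fun n => ?_⟩
    · simp [taylor_ι, Polynomial.algebraMap_apply, contract_algebraMap]
    · rcases n with _ | _ | n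
      · simp [taylor_ι, superDer_ι, Polynomial.algebraMap_apply, superDer_algebraMap, contract_ι,
          hδT]
      · simp [taylor_ι, superDer_ι, Polynomial.algebraMap_apply, Polynomial.coeff_C]
      · simp [taylor_ι, superDer_ι, Polynomial.algebraMap_apply]
  | hmul f g hf hg =>
    refine ⟨?_, fun n => ?_⟩
    · rw [map_mul, Polynomial.mul_coeff_zero, contract_mul, hf.1, hg.1, zero_mul, mul_zero,
        add_zero]
    · rw [superDer_mul, map_add, map_mul, map_mul, map_mul, Polynomial.coeff_add]
      simp only [Polynomial.coeff_mul, map_sum, superDer_mul, contract_mul, hf.2, hg.2,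
        coeff_taylor_twist, Finset.sum_add_distrib, add_mul, mul_add]
      -- The coefficient of index `n + 1` of a product has one more term than that of index `n`. The
      -- extra terms contract a zeroth coefficient and vanish by the first half of the induction
      -- hypothesis, which is why both halves are proved together.
      rw [Finset.Nat.sum_antidiagonal_succ, Finset.Nat.sum_antidiagonal_succ', hf.1, hg.1,
        zero_mul, mul_zero, zero_add, zero_add]
      abel
  | hadd f g hf hg =>
    refine ⟨?_, fun n => ?_⟩
    · rw [map_add, Polynomial.coeff_add, map_add, hf.1, hg.1, add_zero]
    · simp only [map_add, Polynomial.coeff_add, hf.2, hg.2]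
      abel

end

end

end SuperSym

/-! ### Parity projections, even sections and homogeneous bases. -/

section

variable {M N : Type*} [AddCommGroup M] [Module ℂ M] [AddCommGroup N] [Module ℂ N]
  (ℳ : ZMod 2 → Submodule ℂ M) [DirectSum.Decomposition ℳ]
  (𝒩 : ZMod 2 → Submodule ℂ N) [DirectSum.Decomposition 𝒩]

/-- The projection of a superspace to its homogeneous component of parity `i`, as an
endomorphism. -/
def parityProj (i : ZMod 2) : M →ₗ[ℂ] M where
  toFun m := (DirectSum.decompose ℳ m i : M)
  map_add' x y := by simp [DirectSum.decompose_add]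
  map_smul' c x := by rw [DirectSum.decompose_smul]; rfl

theorem parityProj_mem (i : ZMod 2) (m : M) : parityProj ℳ i m ∈ ℳ i := SetLike.coe_mem _

theorem sum_parityProj (m : M) : ∑ i, parityProj ℳ i m = m := sum_decompose ℳ m

theorem parityProj_of_mem {i : ZMod 2} {m : M} (hm : m ∈ ℳ i) : parityProj ℳ i m = m :=
  DirectSum.decompose_of_mem_same ℳ hm

theorem parityProj_of_mem_ne {i j : ZMod 2} {m : M} (hm : m ∈ ℳ i) (h : i ≠ j) :
    parityProj ℳ j m = 0 :=
  DirectSum.decompose_of_mem_ne ℳ hm h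

variable {ℳ 𝒩} in
theorem parityProj_map_add {f : M →ₗ[ℂ] N} {p : ZMod 2} (hf : ∀ i, ∀ a ∈ ℳ i, f a ∈ 𝒩 (p + i))
    (i : ZMod 2) (m : M) : parityProj 𝒩 (p + i) (f m) = f (parityProj ℳ i m) := by
  refine LinearMap.congr_fun (linearMap_ext_of_homogeneous ℳ
    (f := parityProj 𝒩 (p + i) ∘ₗ f) (g := f ∘ₗ parityProj ℳ i) fun j a ha => ?_) m
  rw [LinearMap.comp_apply, LinearMap.comp_apply]
  rcases eq_or_ne j i with rfl | h
  · rw [parityProj_of_mem _ ha, parityProj_of_mem _ (hf _ a ha)]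
  · rw [parityProj_of_mem_ne _ ha h, parityProj_of_mem_ne _ (hf _ a ha) (by simpa using h),
      map_zero]

variable {ℳ 𝒩} in
theorem parityProj_map {f : M →ₗ[ℂ] N} (hf : ∀ i, ∀ a ∈ ℳ i, f a ∈ 𝒩 i) (i : ZMod 2) (m : M) :
    parityProj 𝒩 i (f m) = f (parityProj ℳ i m) := by
  have h := parityProj_map_add (ℳ := ℳ) (𝒩 := 𝒩) (f := f) (p := 0)
    (fun i a ha => by rw [zero_add]; exact hf i a ha) i m
  rwa [zero_add] at h

variable {ℳ 𝒩} in
/-- An even map which is surjective modulo a subsuperspace has an even section modulo it. -/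
theorem exists_even_section {f : M →ₗ[ℂ] N} (hf : ∀ i, ∀ a ∈ ℳ i, f a ∈ 𝒩 i)
    {L : Submodule ℂ N} (hL : IsSubsuperspace 𝒩 L) (hsurj : ∀ n, ∃ m, n - f m ∈ L) :
    ∃ s : N →ₗ[ℂ] M, (∀ i, ∀ n ∈ 𝒩 i, s n ∈ ℳ i) ∧ (∀ n ∈ L, s n = 0) ∧
      ∀ n, n - f (s n) ∈ L := by
  obtain ⟨r, hr⟩ := (L.mkQ ∘ₗ f).exists_rightInverse_of_surjective <| by
    refine LinearMap.range_eq_top.2 fun n => ?_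
    obtain ⟨n, rfl⟩ := L.mkQ_surjective n
    obtain ⟨m, hm⟩ := hsurj n
    exact ⟨m, ((Submodule.Quotient.eq L).2 hm).symm⟩
  have hr' : ∀ n, n - f (r (L.mkQ n)) ∈ L := fun n =>
    (Submodule.Quotient.eq L).1 (LinearMap.congr_fun hr (L.mkQ n)).symm
  -- An arbitrary linear section `r` modulo `L` need not be even; the sum over `i` keeps its even
  -- part, which is still a section since `f` is even and `L` is graded.
  refine ⟨∑ i, parityProj ℳ i ∘ₗ r ∘ₗ L.mkQ ∘ₗ parityProj 𝒩 i, fun i n hn => ?_, fun n hn => ?_,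
    fun n => ?_⟩
  · rw [LinearMap.sum_apply, Finset.sum_eq_single i]
    · exact parityProj_mem _ _ _
    · intro j _ hj
      simp [parityProj_of_mem_ne 𝒩 hn hj.symm]
    · simp
  · rw [LinearMap.sum_apply]
    refine Finset.sum_eq_zero fun i _ => ?_
    have h : L.mkQ (parityProj 𝒩 i n) = 0 := (Submodule.Quotient.mk_eq_zero L).2 (hL n hn i)
    simp only [LinearMap.comp_apply, h, map_zero]
  · have h : n - f ((∑ i, parityProj ℳ i ∘ₗ r ∘ₗ L.mkQ ∘ₗ parityProj 𝒩 i) n) =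
        ∑ i, parityProj 𝒩 i (parityProj 𝒩 i n - f (r (L.mkQ (parityProj 𝒩 i n)))) := by
      simp only [map_sub, Finset.sum_sub_distrib, parityProj_map hf, LinearMap.sum_apply, map_sum,
        LinearMap.comp_apply, parityProj_of_mem 𝒩 (parityProj_mem 𝒩 _ n), sum_parityProj]
    rw [h]
    exact Submodule.sum_mem _ fun i _ => hL _ (hr' _) i

theorem exists_homogeneous_basis [FiniteDimensional ℂ M] :
    ∃ (κ : Type) (_ : Fintype κ) (p : κ → ZMod 2) (b : Module.Basis κ ℂ M),
      (∀ k, b k ∈ ℳ (p k)) ∧ ∀ k i, ∀ x ∈ ℳ i, i ≠ p k → b.repr x k = 0 := by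
  have h := DirectSum.Decomposition.isInternal ℳ
  exact ⟨_, inferInstance, Sigma.fst, h.collectedBasis fun i => Module.finBasis ℂ (ℳ i),
    fun k => h.collectedBasis_mem _ k,
    fun k i x hx hi => h.collectedBasis_repr_of_mem_ne _ hi hx⟩

end

/-! ### Proof of the proposition. -/

namespace LieSuperalgebra

theorem eval_eq_zero_of_mem_dualGrading {V : Type*} [AddCommGroup V] [Module ℂ V]
    {𝒱 : ZMod 2 → Submodule ℂ V} {w₀ : V} (hw₀ : w₀ ∈ 𝒱 0) (α : Module.Dual ℂ V)
    (hα : α ∈ dualGrading 𝒱 1) : Module.Dual.eval ℂ V w₀ α = 0 :=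
  (Submodule.mem_dualAnnihilator _).1 hα _ hw₀

theorem restrictPoly_ι {V : Type*} [AddCommGroup V] [Module ℂ V] (𝒱 : ZMod 2 → Submodule ℂ V)
    (L : Submodule ℂ V) (α : Module.Dual ℂ V) :
    restrictPoly 𝒱 L (SuperSym.ι _ α) = SuperSym.ι _ (L.dualRestrict α) :=
  SuperSym.map_ι _ _ _ _ _

/-- Taylor expansion at a point of `L` commutes with the restriction to `L`. -/
theorem restrictPoly_coeff_taylor {V : Type*} [AddCommGroup V] [Module ℂ V]
    {𝒱 : ZMod 2 → Submodule ℂ V} {L : Submodule ℂ V} {w₀ : V} (hw₀L : w₀ ∈ L) (hw₀ : w₀ ∈ 𝒱 0)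
    (f : SuperSym (dualGrading 𝒱)) (n : ℕ) :
    restrictPoly 𝒱 L ((SuperSym.taylor (dualGrading 𝒱) (Module.Dual.eval ℂ V w₀)
      (eval_eq_zero_of_mem_dualGrading hw₀) f).coeff n) =
    (SuperSym.taylor (dualGrading (subGrading 𝒱 L)) (Module.Dual.eval ℂ L ⟨w₀, hw₀L⟩)
      (eval_eq_zero_of_mem_dualGrading hw₀) (restrictPoly 𝒱 L f)).coeff n := by
  have h : (Polynomial.mapAlgHom (restrictPoly 𝒱 L)).comp
      (SuperSym.taylor (dualGrading 𝒱) (Module.Dual.eval ℂ V w₀)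
        (eval_eq_zero_of_mem_dualGrading hw₀)) =
      (SuperSym.taylor (dualGrading (subGrading 𝒱 L)) (Module.Dual.eval ℂ L ⟨w₀, hw₀L⟩)
        (eval_eq_zero_of_mem_dualGrading hw₀)).comp (restrictPoly 𝒱 L) :=
    SuperSym.algHom_ext fun α => by
      rw [AlgHom.comp_apply, AlgHom.comp_apply, restrictPoly_ι, SuperSym.taylor_ι,
        SuperSym.taylor_ι, map_add, map_mul, AlgHom.commutes]
      simp [restrictPoly_ι]
  have h' := congrArg (fun q => Polynomial.coeff q n) (AlgHom.congr_fun h f)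
  simpa using h'

variable {𝔤 : Type*} [AddCommGroup 𝔤] [Module ℂ 𝔤]
  {𝒢 : ZMod 2 → Submodule ℂ 𝔤}
  [DirectSum.Decomposition 𝒢] {A : LieSuperalgebra 𝒢} {V : Type*} [AddCommGroup V] [Module ℂ V]
  {𝒱 : ZMod 2 → Submodule ℂ V} [DirectSum.Decomposition 𝒱] (ρ : A.Rep 𝒱)
  {L : Submodule ℂ V} {w₀ : V}

/-- The linear form `α ↦ (x α)(w₀)` on `V*`. -/
def Rep.evalAct (p : ZMod 2) (x : 𝔤) (w₀ : V) : Module.Dual ℂ V →ₗ[ℂ] ℂ :=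
  Module.Dual.eval ℂ V w₀ ∘ₗ ρ.dualAct p x

/-- Since `w₀` is even, `x w₀` has parity `p` and only forms of parity `p` see it. The sign, which
depends on the parity of `α`, can therefore be fixed as `superSign p p`, giving a formula for all
`α`. -/
theorem Rep.evalAct_apply {p : ZMod 2} {x : 𝔤} (hx : x ∈ 𝒢 p) (hw₀ : w₀ ∈ 𝒱 0)
    (α : Module.Dual ℂ V) : ρ.evalAct p x w₀ α = -(superSign p p * α (ρ.act x w₀)) := by
  refine LinearMap.congr_fun (linearMap_ext_of_homogeneous (dualGrading 𝒱)
    (f := ρ.evalAct p x w₀) (g := -(superSign p p • Module.Dual.eval ℂ V (ρ.act x w₀)))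
    fun i α hα => ?_) α
  change ρ.dualAct p x α w₀ = -(superSign p p * α (ρ.act x w₀))
  rw [ρ.dualAct_apply x hα]
  rcases eq_or_ne i p with rfl | h
  · rfl
  · have hi : ∀ i p : ZMod 2, i ≠ p → p + 0 = i + 1 := by decide
    have := ρ.act_mem p 0 x hx w₀ hw₀
    rw [hi i p h] at this
    rw [(Submodule.mem_dualAnnihilator _).1 hα _ this, mul_zero, mul_zero]

theorem Rep.evalAct_eq_zero {p : ZMod 2} {x : 𝔤} (hx : x ∈ 𝒢 p) (hw₀ : w₀ ∈ 𝒱 0) (i : ZMod 2)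
    (α : Module.Dual ℂ V) (hα : α ∈ dualGrading 𝒱 i) (h : i ≠ p) : ρ.evalAct p x w₀ α = 0 := by
  have hi : ∀ i p : ZMod 2, i ≠ p → p + i = 1 := by decide
  have := ρ.dualAct_mem hx i α hα
  rw [hi i p h] at this
  exact eval_eq_zero_of_mem_dualGrading hw₀ _ this

/-- A polynomial on `V` which is killed by all the constant vector fields `x w₀`, and whose
restriction to `L` vanishes, is zero. -/
theorem Rep.eq_zero_of_contract_eq_zero [FiniteDimensional ℂ 𝔤] (hL : IsSubsuperspace 𝒱 L) (hw₀ : w₀ ∈ 𝒱 0)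
    (hsurj : Function.Surjective fun xw : 𝔤 × L => ρ.act xw.1 w₀ + (xw.2 : V))
    {f : SuperSym (dualGrading 𝒱)} (hf : restrictPoly 𝒱 L f = 0)
    (hc : ∀ (p : ZMod 2) (x : 𝔤) (hx : x ∈ 𝒢 p), SuperSym.contract (dualGrading 𝒱) p
      (ρ.evalAct p x w₀) (ρ.evalAct_eq_zero hx hw₀) f = 0) : f = 0 := by
  obtain ⟨s, hs, hsL, hsec⟩ := exists_even_section (f := ρ.act.flip w₀) (ℳ := 𝒢) (𝒩 := 𝒱)
    (fun i x hx => by simpa using ρ.act_mem i 0 x hx w₀ hw₀) hL fun n => by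
      obtain ⟨⟨x, w⟩, h⟩ := hsurj n
      refine ⟨x, ?_⟩
      have : n - ρ.act.flip w₀ x = w := by
        rw [← h]
        simp
      exact this ▸ w.2
  -- `q` is an even projection with kernel `L` and image inside `𝔤 w₀`.
  set q : V →ₗ[ℂ] V := ρ.act.flip w₀ ∘ₗ s with hq
  have hq_even : ∀ i, ∀ v ∈ 𝒱 i, q v ∈ 𝒱 i := fun i v hv => by
    have := ρ.act_mem i 0 _ (hs i v hv) w₀ hw₀
    rwa [add_zero] at this
  have hq_zero : ∀ v ∈ L, q v = 0 := fun v hv => by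
    rw [hq, LinearMap.comp_apply, hsL v hv, map_zero]
  have hq_idem : ∀ v, q (q v) = q v := fun v => by
    have := hq_zero _ (hsec v)
    rw [map_sub, sub_eq_zero] at this
    exact this.symm
  have hdual : ∀ g : V →ₗ[ℂ] V, (∀ i, ∀ v ∈ 𝒱 i, g v ∈ 𝒱 i) → ∀ i, ∀ α ∈ dualGrading 𝒱 i,
      g.dualMap α ∈ dualGrading 𝒱 i := fun g hg i α hα =>
    (Submodule.mem_dualAnnihilator _).2 fun v hv =>
      (Submodule.mem_dualAnnihilator _).1 hα _ (hg _ v hv)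
  have hπ : ∀ i, ∀ α ∈ dualGrading 𝒱 i, q.dualMap α ∈ dualGrading 𝒱 (0 + i) := fun i α hα => by
    rw [zero_add]
    exact hdual q hq_even i α hα
  have hσ := hdual (LinearMap.id - q) fun i v hv => Submodule.sub_mem _ hv (hq_even i v hv)
  obtain ⟨κ, _, p, b, hb, hb'⟩ := exists_homogeneous_basis 𝒢
  -- Expanding `s v` in a homogeneous basis `b` of `𝔤` writes the transpose of `q` through the forms
  -- `α ↦ (b k α)(w₀)`, whose contractions kill `f`. The sign in the coefficients `y k` undoes the
  -- one in `evalAct_apply`.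
  have heuler : SuperSym.superDer (dualGrading 𝒱) 0 q.dualMap hπ f = 0 := by
    rw [SuperSym.superDer_zero_eq_sum (dualGrading 𝒱) q.dualMap hπ p
      (fun k => ρ.evalAct (p k) (b k) w₀) (fun k => ρ.evalAct_eq_zero (hb k) hw₀)
      (fun k => -(superSign (p k) (p k) • (b.coord k ∘ₗ s : Module.Dual ℂ V))) (fun k => ?_)
      (fun α => ?_) f]
    · exact Finset.sum_eq_zero fun k _ => by rw [hc _ (b k) (hb k), mul_zero]
    · refine Submodule.neg_mem _ (Submodule.smul_mem _ _
        ((Submodule.mem_dualAnnihilator _).2 fun v hv => ?_))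
      exact hb' k _ _ (hs _ v hv) (by simp)
    · ext v
      have hv : q v = ∑ k, b.repr (s v) k • ρ.act (b k) w₀ := by
        conv_lhs => rw [hq, LinearMap.comp_apply, ← b.sum_repr (s v), map_sum]
        simp
      rw [LinearMap.dualMap_apply, hv, map_sum, LinearMap.sum_apply]
      refine Finset.sum_congr rfl fun k _ => ?_
      rw [ρ.evalAct_apply (hb k) hw₀, map_smul]
      simp only [LinearMap.smul_apply, LinearMap.neg_apply, smul_eq_mul, LinearMap.comp_apply,
        Module.Basis.coord_apply]
      linear_combination (-(b.repr (s v) k * α (ρ.act (b k) w₀))) * superSign_mul_self (p k) (p k)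
  rw [← SuperSym.eq_map_of_superDer_eq_zero (dualGrading 𝒱) q.dualMap hπ
    (fun α => by ext v; simp [hq_idem]) (LinearMap.id - q).dualMap hσ
    (fun α => by ext v; simp) heuler]
  -- `1 - q` takes values in `L`, so the pullback along it factors through the restriction to `L`.
  let r : V →ₗ[ℂ] L := (LinearMap.id - q).codRestrict L hsec
  have hr : ∀ i, ∀ β ∈ dualGrading (subGrading 𝒱 L) i, r.dualMap β ∈ dualGrading 𝒱 i :=
    fun i β hβ => (Submodule.mem_dualAnnihilator _).2 fun v hv =>
      (Submodule.mem_dualAnnihilator _).1 hβ _ (Submodule.sub_mem _ hv (hq_even _ v hv))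
  have hfac : SuperSym.map (dualGrading 𝒱) (dualGrading 𝒱) (LinearMap.id - q).dualMap hσ =
      (SuperSym.map (dualGrading (subGrading 𝒱 L)) (dualGrading 𝒱) r.dualMap hr).comp
        (restrictPoly 𝒱 L) := SuperSym.algHom_ext fun α => by
    rw [AlgHom.comp_apply, restrictPoly_ι, SuperSym.map_ι, SuperSym.map_ι]
    rfl
  rw [hfac, AlgHom.comp_apply, hf, map_zero]

/-- Invariant polynomials on `V` are determined by their restrictions to `L`, provided that
`𝔤 w₀ + L = V` for some even `w₀ ∈ L`. -/
theorem Rep.restrictPoly_invariants_injective [FiniteDimensional ℂ 𝔤] (hL : IsSubsuperspace 𝒱 L) (hw₀L : w₀ ∈ L)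
    (hw₀ : w₀ ∈ 𝒱 0)
    (hsurj : Function.Surjective fun xw : 𝔤 × L => ρ.act xw.1 w₀ + (xw.2 : V)) :
    Function.Injective ((restrictPoly 𝒱 L).comp ρ.invariants.val) := by
  rw [injective_iff_map_eq_zero]
  rintro ⟨f, hf⟩ hfL
  replace hfL : restrictPoly 𝒱 L f = 0 := hfL
  suffices h : ∀ n, (SuperSym.taylor (dualGrading 𝒱) (Module.Dual.eval ℂ V w₀)
      (eval_eq_zero_of_mem_dualGrading hw₀) f).coeff n = 0 by
    refine Subtype.ext (SuperSym.taylor_injective (dualGrading 𝒱) (Module.Dual.eval ℂ V w₀)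
      (eval_eq_zero_of_mem_dualGrading hw₀) ?_)
    ext n
    change _ = Polynomial.coeff (SuperSym.taylor _ _ _ 0) n
    rw [h, map_zero, Polynomial.coeff_zero]
  intro n
  induction n with
  | zero =>
    refine ρ.eq_zero_of_contract_eq_zero hL hw₀ hsurj ?_ fun p x hx => ?_
    · rw [restrictPoly_coeff_taylor hw₀L hw₀, hfL, map_zero, Polynomial.coeff_zero]
    · exact (SuperSym.coeff_taylor_superDer (dualGrading 𝒱) _
        (eval_eq_zero_of_mem_dualGrading hw₀) p (ρ.dualAct p x) (ρ.dualAct_mem hx)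
        (ρ.evalAct p x w₀) (ρ.evalAct_eq_zero hx hw₀) (fun α => rfl) f).1
  | succ n ih =>
    refine ρ.eq_zero_of_contract_eq_zero hL hw₀ hsurj ?_ fun p x hx => ?_
    · rw [restrictPoly_coeff_taylor hw₀L hw₀, hfL, map_zero, Polynomial.coeff_zero]
    · have h := (SuperSym.coeff_taylor_superDer (dualGrading 𝒱) _
        (eval_eq_zero_of_mem_dualGrading hw₀) p (ρ.dualAct p x) (ρ.dualAct_mem hx)
        (ρ.evalAct p x w₀) (ρ.evalAct_eq_zero hx hw₀) (fun α => rfl) f).2 n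
      -- Invariance kills the left side of `h` and `ih` the linear part, leaving only the
      -- contraction of the next coefficient.
      have hfx : SuperSym.superDer (dualGrading 𝒱) p (ρ.dualAct p x) (ρ.dualAct_mem hx) f = 0 :=
        hf p x hx
      rwa [hfx, map_zero, Polynomial.coeff_zero, ih, map_zero, zero_add, eq_comm] at h

end LieSuperalgebra

/-- If `T - c` is locally nilpotent at `v` for some `c ≠ 0`, then `v` is in the range of `T`. -/
theorem mem_range_of_sub_smul_pow_eq_zero {V : Type*} [AddCommGroup V] [Module ℂ V]
    (T : Module.End ℂ V) {c : ℂ} (hc : c ≠ 0) (k : ℕ) (v : V)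
    (h : ((T - c • 1) ^ k) v = 0) : v ∈ LinearMap.range T := by
  induction k generalizing v with
  | zero =>
    have : v = 0 := by simpa using h
    exact this ▸ Submodule.zero_mem _
  | succ k ih =>
    rw [pow_succ, Module.End.mul_apply] at h
    have h1 := ih _ h
    have h2 : c • v ∈ LinearMap.range T := by
      have : c • v = T v - (T - c • 1) v := by simp
      rw [this]
      exact Submodule.sub_mem _ (LinearMap.mem_range_self T v) h1
    exact (Submodule.smul_mem_iff _ hc).1 h2

/-! ### Even and odd elements; the even part as a Lie algebra acting on `𝔤`. -/

namespace LieSuperalgebra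

section

variable {𝔤 : Type*} [AddCommGroup 𝔤] [Module ℂ 𝔤] {𝒢 : ZMod 2 → Submodule ℂ 𝔤}
  [DirectSum.Decomposition 𝒢] (A : LieSuperalgebra 𝒢)

theorem jacobi_even {x : 𝔤} (hx : x ∈ 𝒢 0) (y z : 𝔤) :
    A.bracket x (A.bracket y z) =
      A.bracket (A.bracket x y) z + A.bracket y (A.bracket x z) := by
  rw [← sum_parityProj 𝒢 y]
  simp only [map_sum, LinearMap.sum_apply, ← Finset.sum_add_distrib]
  refine Finset.sum_congr rfl fun j _ => ?_
  rw [A.jacobi 0 j x hx _ (parityProj_mem 𝒢 j y), superSign_zero_left, one_smul]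

theorem bracket_skew_even {x : 𝔤} (hx : x ∈ 𝒢 0) (y : 𝔤) :
    A.bracket x y = -A.bracket y x := by
  rw [← sum_parityProj 𝒢 y]
  simp only [map_sum, LinearMap.sum_apply, ← Finset.sum_neg_distrib]
  refine Finset.sum_congr rfl fun j _ => ?_
  rw [A.bracket_skew 0 j x hx _ (parityProj_mem 𝒢 j y), superSign_zero_left, one_smul]

/-- For `x = y` odd the sign in the Jacobi identity is `-1`, so its two double brackets add up.
Nilpotency of an odd operator is thereby reduced to that of the even `[x, x]`. -/
theorem bracket_bracket_self_odd {x : 𝔤} (hx : x ∈ 𝒢 1) (z : 𝔤) :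
    A.bracket x (A.bracket x z) = (2⁻¹ : ℂ) • A.bracket (A.bracket x x) z := by
  have h := A.jacobi 1 1 x hx x hx z
  have hs : superSign 1 1 = -1 := by simp [superSign, ZMod.val_one]
  rw [hs, neg_one_smul, ← sub_eq_add_neg, eq_sub_iff_add_eq, ← two_smul ℂ] at h
  rw [← h, smul_smul, inv_mul_cancel₀ two_ne_zero, one_smul]

/-- The even part of a Lie superalgebra, as an ordinary Lie algebra. -/
def EvenPart (_A : LieSuperalgebra 𝒢) : Type _ := 𝒢 0

namespace EvenPart

instance : AddCommGroup A.EvenPart := inferInstanceAs (AddCommGroup (𝒢 0))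

instance : Module ℂ A.EvenPart := inferInstanceAs (Module ℂ (𝒢 0))

instance [FiniteDimensional ℂ 𝔤] : FiniteDimensional ℂ A.EvenPart :=
  inferInstanceAs (FiniteDimensional ℂ (𝒢 0))

/-- The inclusion of the even part. -/
def incl : A.EvenPart →ₗ[ℂ] 𝔤 := (𝒢 0).subtype

variable {A}

theorem incl_mem (x : A.EvenPart) : incl A x ∈ 𝒢 0 := SetLike.coe_mem (p := 𝒢 0) x

theorem incl_injective : Function.Injective (incl A) := Subtype.val_injective

instance : LieRing A.EvenPart where
  bracket x y := (⟨A.bracket (incl A x) (incl A y),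
    A.bracket_mem 0 0 _ (incl_mem x) _ (incl_mem y)⟩ : 𝒢 0)
  add_lie x y z := incl_injective <| by
    change A.bracket (incl A (x + y)) (incl A z) = _
    rw [map_add, map_add]; rfl
  lie_add x y z := incl_injective <| by
    change A.bracket (incl A x) (incl A (y + z)) = _
    rw [map_add, map_add]; rfl
  lie_self x := incl_injective <| by
    change A.bracket (incl A x) (incl A x) = 0
    have h := A.bracket_skew_even (incl_mem x) (incl A x)
    rw [eq_neg_iff_add_eq_zero, ← two_smul ℂ] at h
    exact (smul_eq_zero.1 h).resolve_left two_ne_zero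
  leibniz_lie x y z := incl_injective (A.jacobi_even (incl_mem x) (incl A y) (incl A z))

theorem incl_lie (x y : A.EvenPart) : incl A ⁅x, y⁆ = A.bracket (incl A x) (incl A y) := rfl

instance : LieAlgebra ℂ A.EvenPart where
  lie_smul c x y := incl_injective <| by
    rw [map_smul, incl_lie, incl_lie, map_smul, map_smul]

instance : LieRingModule A.EvenPart 𝔤 where
  bracket x m := A.bracket (incl A x) m
  add_lie x y m := by
    change A.bracket (incl A (x + y)) m = _
    rw [map_add, map_add]; rfl
  lie_add x m n := map_add _ _ _
  leibniz_lie x y m := A.jacobi_even (incl_mem x) (incl A y) m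

theorem lie_eq (x : A.EvenPart) (m : 𝔤) : ⁅x, m⁆ = A.bracket (incl A x) m := rfl

instance : LieModule ℂ A.EvenPart 𝔤 where
  smul_lie c x m := by
    rw [lie_eq, map_smul, map_smul]; rfl
  lie_smul c x m := map_smul _ _ _

end EvenPart

/-- An even element acts by derivations, hence brackets of vectors on which it is locally
nilpotent are again such. -/
theorem pow_bracket_eq_zero {x : 𝔤} (hx : x ∈ 𝒢 0) (m n : ℕ) (y v : 𝔤)
    (hy : (A.bracket x ^ m) y = 0) (hv : (A.bracket x ^ n) v = 0) :
    (A.bracket x ^ (m + n)) (A.bracket y v) = 0 := by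
  -- The Leibniz rule lowers one of the two exponents and leaves the other, hence the induction on
  -- their sum with `y` and `v` free.
  have key : ∀ N m n : ℕ, m + n = N → ∀ y v : 𝔤, (A.bracket x ^ m) y = 0 →
      (A.bracket x ^ n) v = 0 → (A.bracket x ^ N) (A.bracket y v) = 0 := by
    intro N
    induction N with
    | zero =>
      intro m n h y v hy hv
      obtain ⟨rfl, rfl⟩ : m = 0 ∧ n = 0 := by omega
      have hy' : y = 0 := by simpa using hy
      simp [hy']
    | succ N ih =>
      intro m n h y v hy hv
      rcases m with _ | m
      · have hy' : y = 0 := by simpa using hy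
        simp [hy']
      rcases n with _ | n
      · have hv' : v = 0 := by simpa using hv
        simp [hv']
      rw [pow_succ, Module.End.mul_apply, A.jacobi_even hx, map_add]
      rw [ih m (n + 1) (by omega) _ _ (by rwa [pow_succ, Module.End.mul_apply] at hy) hv,
        ih (m + 1) n (by omega) _ _ hy (by rwa [pow_succ, Module.End.mul_apply] at hv), add_zero]
  exact key _ m n rfl y v hy hv

/-! ### Cartan subalgebras: an Engel-type argument. -/

variable {A} {𝔥 : Submodule ℂ 𝔤}

namespace IsCartan

theorem parityProj_mem (h : A.IsCartan 𝔥) {y : 𝔤} (hy : y ∈ 𝔥) (i : ZMod 2) :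
    parityProj 𝒢 i y ∈ 𝔥 := h.subsuperspace y hy i

theorem lowerCentral_le (h : A.IsCartan 𝔥) (k : ℕ) : A.lowerCentral 𝔥 k ≤ 𝔥 := by
  induction k with
  | zero => exact le_rfl
  | succ k ih => exact Submodule.map₂_le.2 fun x hx y hy => h.bracket_mem x hx y (ih hy)

/-- A bracket with a homogeneous element shifts parity, so gradedness passes down the series. It
permits testing only homogeneous elements of each term. -/
theorem parityProj_lowerCentral (h : A.IsCartan 𝔥) (k : ℕ) (i : ZMod 2) {y : 𝔤}
    (hy : y ∈ A.lowerCentral 𝔥 k) : parityProj 𝒢 i y ∈ A.lowerCentral 𝔥 k := by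
  induction k generalizing i y with
  | zero => exact h.parityProj_mem hy i
  | succ k ih =>
    suffices hle : A.lowerCentral 𝔥 (k + 1) ≤
        (A.lowerCentral 𝔥 (k + 1)).comap (parityProj 𝒢 i) from hle hy
    refine Submodule.map₂_le.2 fun x hx z hz => ?_
    rw [Submodule.mem_comap, ← sum_parityProj 𝒢 x, map_sum, LinearMap.sum_apply, map_sum]
    refine Submodule.sum_mem _ fun j _ => ?_
    have hproj := parityProj_map_add (f := A.bracket (parityProj 𝒢 j x))
      (fun l a ha => A.bracket_mem j l _ (_root_.parityProj_mem 𝒢 j x) a ha) (i - j) z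
    rw [add_sub_cancel] at hproj
    rw [hproj]
    exact Submodule.apply_mem_map₂ _ (h.parityProj_mem hx j) (ih _ hz)

theorem pow_bracket_mem {x y : 𝔤} (hx : x ∈ 𝔥) (hy : y ∈ 𝔥) (k : ℕ) :
    (A.bracket x ^ k) y ∈ A.lowerCentral 𝔥 k := by
  induction k with
  | zero => exact hy
  | succ k ih =>
    rw [pow_succ', Module.End.mul_apply]
    exact Submodule.apply_mem_map₂ _ hx ih

theorem exists_pow_bracket_eq_zero (h : A.IsCartan 𝔥) {x y : 𝔤} (hx : x ∈ 𝔥) (hy : y ∈ 𝔥) :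
    ∃ k, (A.bracket x ^ k) y = 0 := by
  obtain ⟨k, hk⟩ := h.nilpotent
  exact ⟨k, by simpa [hk] using pow_bracket_mem (A := A) hx hy k⟩

/-- A homogeneous element of a Cartan subalgebra acts locally nilpotently wherever the even
elements do. -/
theorem exists_pow_bracket_eq_zero_of_even (h : A.IsCartan 𝔥) {v : 𝔤}
    (hv : ∀ x ∈ 𝔥, x ∈ 𝒢 0 → ∃ k, (A.bracket x ^ k) v = 0) {i : ZMod 2} {c : 𝔤} (hc : c ∈ 𝔥)
    (hci : c ∈ 𝒢 i) : ∃ k, (A.bracket c ^ k) v = 0 := by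
  have hi : ∀ i : ZMod 2, i = 0 ∨ i = 1 := by decide
  rcases hi i with rfl | rfl
  · exact hv c hc hci
  · obtain ⟨k, hk⟩ := hv _ (h.bracket_mem c hc c hc) (A.bracket_mem 1 1 c hci c hci)
    have hsq : A.bracket c ^ 2 = (2⁻¹ : ℂ) • A.bracket (A.bracket c c) := by
      ext z
      rw [pow_two, Module.End.mul_apply, A.bracket_bracket_self_odd hci, LinearMap.smul_apply]
    exact ⟨2 * k, by rw [pow_mul, hsq, smul_pow, LinearMap.smul_apply, hk, smul_zero]⟩

/-- An element which the Cartan subalgebra brackets into itself belongs to it. -/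
theorem mem_of_bracket_mem (h : A.IsCartan 𝔥) {v : 𝔤} (hv : ∀ y ∈ 𝔥, A.bracket y v ∈ 𝔥) :
    v ∈ 𝔥 := by
  refine h.self_normalizing v fun y hy => ?_
  rw [← sum_parityProj 𝒢 v, ← sum_parityProj 𝒢 y]
  simp only [map_sum, LinearMap.sum_apply]
  refine Submodule.sum_mem _ fun j _ => Submodule.sum_mem _ fun i _ => ?_
  -- Skew symmetry holds only for homogeneous elements, so `[v, y]` is treated by components: up to
  -- sign, each is a parity component of some `[yⱼ, v] ∈ 𝔥`.
  have hproj (i j : ZMod 2) := parityProj_map_add (f := A.bracket (parityProj 𝒢 j y))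
    (fun l a ha => A.bracket_mem j l _ (_root_.parityProj_mem 𝒢 j y) a ha) i v
  rw [A.bracket_skew _ _ _ (_root_.parityProj_mem 𝒢 _ v) _ (_root_.parityProj_mem 𝒢 _ y),
    ← hproj]
  exact Submodule.neg_mem _ (Submodule.smul_mem _ _
    (h.parityProj_mem (hv _ (h.parityProj_mem hy _)) _))

/-- A stable subspace on which the even elements of a Cartan subalgebra act locally nilpotently is
contained in the Cartan subalgebra. -/
theorem le_of_locally_nilpotent [FiniteDimensional ℂ 𝔤] (h : A.IsCartan 𝔥) {W₀ : Submodule ℂ 𝔤}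
    (hle : 𝔥 ≤ W₀) (hstable : ∀ y ∈ 𝔥, ∀ w ∈ W₀, A.bracket y w ∈ W₀)
    (hnil : ∀ w ∈ W₀, ∀ x ∈ 𝔥, x ∈ 𝒢 0 → ∃ k, (A.bracket x ^ k) w = 0) : W₀ ≤ 𝔥 := by
  by_contra hnot
  -- Take `W` minimal among the stable subspaces strictly above `𝔥`. It will follow that `[𝔥, W] ⊆
  -- 𝔥`, descending from the zero term of the lower central series to `𝔥` itself.
  obtain ⟨W, ⟨hW, hWW₀, hWstable⟩, hmin⟩ := wellFounded_lt.has_min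
    {W : Submodule ℂ 𝔤 | 𝔥 < W ∧ W ≤ W₀ ∧ ∀ y ∈ 𝔥, ∀ w ∈ W, A.bracket y w ∈ W}
    ⟨W₀, lt_of_le_not_ge hle hnot, le_rfl, hstable⟩
  obtain ⟨v, hvW, hv⟩ := SetLike.exists_of_lt hW
  have step : ∀ k, (∀ c ∈ A.lowerCentral 𝔥 (k + 1), ∀ w ∈ W, A.bracket c w ∈ 𝔥) →
      ∀ c ∈ A.lowerCentral 𝔥 k, ∀ w ∈ W, A.bracket c w ∈ 𝔥 := by
    intro k ih
    have hom : ∀ i, ∀ c ∈ A.lowerCentral 𝔥 k, c ∈ 𝒢 i → ∀ w ∈ W, A.bracket c w ∈ 𝔥 := by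
      intro i c hc hci
      have hc𝔥 := h.lowerCentral_le k hc
      let W' := W ⊓ 𝔥.comap (A.bracket c)
      suffices hWW' : W' = W from fun w hw => (hWW' ▸ hw : w ∈ W').2
      refine (inf_le_left.lt_or_eq).resolve_left (hmin W' ⟨?_, inf_le_left.trans hWW₀, ?_⟩)
      -- If `W' ≤ 𝔥`, then `[c, w] ∈ 𝔥` forces `w ∈ 𝔥` on `W`; since a power of `ad c` kills `v`,
      -- this leads back to `v ∈ 𝔥`.
      · refine lt_of_le_not_ge (le_inf hW.le fun y hy => h.bracket_mem c hc𝔥 y hy) fun hle' => ?_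
        have hpowW : ∀ n, (A.bracket c ^ n) v ∈ W := fun n => by
          induction n with
          | zero => exact hvW
          | succ n ihn =>
            rw [pow_succ', Module.End.mul_apply]
            exact hWstable c hc𝔥 _ ihn
        have hpow : ∀ n, (A.bracket c ^ n) v ∈ 𝔥 → v ∈ 𝔥 := fun n => by
          induction n with
          | zero => exact id
          | succ n ihn =>
            intro hn
            rw [pow_succ', Module.End.mul_apply] at hn
            exact ihn (hle' ⟨hpowW n, hn⟩)
        obtain ⟨n, hn⟩ := h.exists_pow_bracket_eq_zero_of_even (hnil v (hWW₀ hvW)) hc𝔥 hci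
        exact hv (hpow n (hn ▸ Submodule.zero_mem _))
      · rintro y hy w ⟨hw, hcw⟩
        refine ⟨hWstable y hy w hw, ?_⟩
        change A.bracket c (A.bracket y w) ∈ 𝔥
        rw [← sum_parityProj 𝒢 y, map_sum, LinearMap.sum_apply, map_sum]
        refine Submodule.sum_mem _ fun j _ => ?_
        have hyj := h.parityProj_mem hy j
        have hyj' := _root_.parityProj_mem 𝒢 j y
        -- Exchanging `c` and `y` costs a bracket in the next term of the lower central series,
        -- where `ih` applies.
        rw [A.jacobi i j c hci _ hyj', A.bracket_skew i j c hci _ hyj']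
        refine Submodule.add_mem _ (ih _ ?_ w hw)
          (Submodule.smul_mem _ _ (h.bracket_mem _ hyj _ hcw))
        exact Submodule.neg_mem _ (Submodule.smul_mem _ _ (Submodule.apply_mem_map₂ _ hyj hc))
    intro c hc w hw
    rw [← sum_parityProj 𝒢 c, map_sum, LinearMap.sum_apply]
    exact Submodule.sum_mem _ fun i _ =>
      hom i _ (h.parityProj_lowerCentral k i hc) (_root_.parityProj_mem 𝒢 i c) w hw
  have descend : ∀ k, (∀ c ∈ A.lowerCentral 𝔥 k, ∀ w ∈ W, A.bracket c w ∈ 𝔥) →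
      ∀ c ∈ 𝔥, ∀ w ∈ W, A.bracket c w ∈ 𝔥 := fun k => by
    induction k with
    | zero => exact id
    | succ k ih => exact fun hk => ih (step k hk)
  obtain ⟨k, hk⟩ := h.nilpotent
  refine hv (h.mem_of_bracket_mem fun y hy => descend k (fun c hc w _ => ?_) y hy v hvW)
  rw [hk, Submodule.mem_bot] at hc
  rw [hc, map_zero]
  exact Submodule.zero_mem _

/-! ### A generic even element of a Cartan subalgebra. -/

/-- The even part of a Cartan subalgebra, as a Lie subalgebra of the even part. -/
def evenSubalgebra (h : A.IsCartan 𝔥) : LieSubalgebra ℂ A.EvenPart where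
  __ := 𝔥.comap (EvenPart.incl A)
  lie_mem' hx hy := h.bracket_mem _ hx _ hy

/-- By Engel's theorem it is enough that each `ad x` is nilpotent, and its powers descend the lower
central series of `𝔥`. -/
theorem isNilpotent_evenSubalgebra [FiniteDimensional ℂ 𝔤] (h : A.IsCartan 𝔥) :
    LieRing.IsNilpotent h.evenSubalgebra := by
  rw [LieAlgebra.isNilpotent_iff_forall (R := ℂ)]
  intro x
  obtain ⟨k, hk⟩ := h.nilpotent
  refine ⟨k, ?_⟩
  ext y
  have hpow : ∀ n, EvenPart.incl A (((LieAlgebra.ad ℂ h.evenSubalgebra x) ^ n) y : _) =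
      (A.bracket (EvenPart.incl A x) ^ n) (EvenPart.incl A y) := fun n => by
    induction n with
    | zero => rfl
    | succ n ih =>
      rw [pow_succ', Module.End.mul_apply, pow_succ', Module.End.mul_apply, ← ih]
      rfl
  have h0 := pow_bracket_mem (A := A) x.2 y.2 k
  rw [hk, Submodule.mem_bot] at h0
  refine EvenPart.incl_injective ?_
  rw [hpow]
  exact h0

/-- A Cartan subalgebra `𝔥` contains an even element `w₀` with `[𝔤, w₀] + 𝔥 = 𝔤`. -/
theorem exists_surjective [FiniteDimensional ℂ 𝔤] (h : A.IsCartan 𝔥) :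
    ∃ w₀ ∈ 𝔥, w₀ ∈ 𝒢 0 ∧
      Function.Surjective fun xw : 𝔤 × 𝔥 => A.adjoint.act xw.1 w₀ + (xw.2 : 𝔤) := by
  have := h.isNilpotent_evenSubalgebra
  let H := h.evenSubalgebra
  have hend : ∀ x : H, LieModule.toEnd ℂ H 𝔤 x = A.bracket (EvenPart.incl A x) := fun x => rfl
  -- There are finitely many nonzero weights and they are linear, so some `x` lies off all their
  -- kernels.
  obtain ⟨x, -, hx⟩ := Module.Dual.exists_forall_mem_ne_zero_of_forall_exists
    (⊤ : Submodule ℂ H)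
    (fun χ : {χ : LieModule.Weight ℂ H 𝔤 // χ.IsNonZero} =>
      LieModule.Weight.toLinear ℂ H 𝔤 χ.1) fun χ => by
    by_contra! hχ
    exact χ.2 (funext fun y => hχ y trivial)
  -- The zero weight space is where all even elements of `𝔥` act nilpotently. It contains `𝔥` and is
  -- stable under all of `𝔥`, odd elements included, because even elements act by derivations.
  have hzero : (LieModule.genWeightSpace 𝔤 (0 : H → ℂ) : Submodule ℂ 𝔤) ≤ 𝔥 := by
    have hmem : ∀ v, v ∈ (LieModule.genWeightSpace 𝔤 (0 : H → ℂ) : Submodule ℂ 𝔤) ↔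
        ∀ y ∈ 𝔥, y ∈ 𝒢 0 → ∃ k, (A.bracket y ^ k) v = 0 := fun v => by
      rw [LieSubmodule.mem_toSubmodule, LieModule.mem_genWeightSpace]
      simp only [Pi.zero_apply, zero_smul, sub_zero, hend]
      exact ⟨fun hv y hy hy0 => hv ⟨(⟨y, hy0⟩ : 𝒢 0), hy⟩,
        fun hv y => hv _ y.2 (EvenPart.incl_mem _)⟩
    refine h.le_of_locally_nilpotent (fun y hy => (hmem y).2 fun x hx _ =>
      h.exists_pow_bracket_eq_zero hx hy) (fun y hy w hw => (hmem _).2 fun z hz hz0 => ?_)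
      fun w hw => (hmem w).1 hw
    obtain ⟨m, hm⟩ := h.exists_pow_bracket_eq_zero hz hy
    obtain ⟨n, hn⟩ := (hmem w).1 hw z hz hz0
    exact ⟨m + n, A.pow_bracket_eq_zero hz0 m n y w hm hn⟩
  have htop : LinearMap.range (A.bracket (EvenPart.incl A x)) ⊔ 𝔥 = ⊤ := by
    rw [eq_top_iff, ← LieSubmodule.top_toSubmodule (R := ℂ) (L := H) (M := 𝔤),
      ← LieModule.iSup_genWeightSpace_eq_top' ℂ H 𝔤, LieSubmodule.iSup_toSubmodule]
    refine iSup_le fun χ => ?_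
    by_cases hχ : χ.IsZero
    · rw [hχ]
      exact hzero.trans le_sup_right
    · refine le_trans (fun v hv => ?_) le_sup_left
      obtain ⟨k, hk⟩ := (LieModule.mem_genWeightSpace 𝔤 χ v).1 hv x
      exact mem_range_of_sub_smul_pow_eq_zero _ (hx ⟨χ, hχ⟩) k v hk
  refine ⟨EvenPart.incl A x, x.2, EvenPart.incl_mem _, fun z => ?_⟩
  obtain ⟨_, ⟨y, rfl⟩, w, hw, hz⟩ := Submodule.mem_sup.1 (htop ▸ Submodule.mem_top : z ∈ _)
  -- The range of `ad x` consists of the `[x, y]`, whereas the surjectivity asks for `[y, x]`; hence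
  -- the minus sign.
  refine ⟨(-y, ⟨w, hw⟩), ?_⟩
  change A.bracket (-y) (EvenPart.incl A x) + w = z
  rw [map_neg, LinearMap.neg_apply, ← A.bracket_skew_even (EvenPart.incl_mem _), hz]

end IsCartan

end

end LieSuperalgebra

end

theorem proposition1p1 :
    (∀ (𝔤 : Type u) [AddCommGroup 𝔤] [Module ℂ 𝔤] [FiniteDimensional ℂ 𝔤]
      (𝒢 : ZMod 2 → Submodule ℂ 𝔤) [DirectSum.Decomposition 𝒢] (A : LieSuperalgebra 𝒢)
      (V : Type v) [AddCommGroup V] [Module ℂ V] [FiniteDimensional ℂ V]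
      (𝒱 : ZMod 2 → Submodule ℂ V) [DirectSum.Decomposition 𝒱] (ρ : A.Rep 𝒱)
      (L : Submodule ℂ V) (_hL : IsSubsuperspace 𝒱 L)
      (w₀ : V) (_hw₀L : w₀ ∈ L) (_hw₀even : w₀ ∈ 𝒱 0)
      (_hsurj : Function.Surjective fun xw : 𝔤 × L => ρ.act xw.1 w₀ + (xw.2 : V)),
      Function.Injective ((restrictPoly 𝒱 L).comp ρ.invariants.val)) ∧
    (∀ (𝔤 : Type u) [AddCommGroup 𝔤] [Module ℂ 𝔤] [FiniteDimensional ℂ 𝔤]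
      (𝒢 : ZMod 2 → Submodule ℂ 𝔤) [DirectSum.Decomposition 𝒢] (A : LieSuperalgebra 𝒢)
      (𝔥 : Submodule ℂ 𝔤) (_h𝔥 : A.IsCartan 𝔥),
      Function.Injective ((restrictPoly 𝒢 𝔥).comp A.adjoint.invariants.val)) := by
  refine ⟨?_, ?_⟩
  · intro 𝔤 _ _ _ 𝒢 _ A V _ _ _ 𝒱 _ ρ L hL w₀ hw₀L hw₀ hsurj
    exact ρ.restrictPoly_invariants_injective hL hw₀L hw₀ hsurj
  · intro 𝔤 _ _ _ 𝒢 _ A 𝔥 h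
    obtain ⟨w₀, hw₀𝔥, hw₀, hsurj⟩ := h.exists_surjective
    exact A.adjoint.restrictPoly_invariants_injective h.subsuperspace hw₀𝔥 hw₀ hsurj
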